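/- **Conventions.** Let $\mathbb F\in\{\mathbb R,\mathbb C\}$ and let $SM_n(\mathbb F)$ be the self-adjoint $n\times n$ matrices over $\mathbb F$, $n\ge 1$. For $A\in SM_d(\mathbb C)^g$ the free spectrahedron $\mathcal D_A$ has the levels $\mathcal D_A(n)=\{X\in SM_n(\mathbb C)^g : \sum_i A_i\otimes X_i\preceq I\}$, and its real version is $\mathcal D_A^{\mathbb R}(n)=\mathcal D_A(n)\cap SM_n(\mathbb R)^g$. A *free simplex* $\mathcal D_S\subset SM(\mathbb C)^g$ is a bounded free spectrahedron defined by $S\in SM_{g+1}(\mathbb C)^g$ whose entries $S_1,\dots,S_g$ are diagonal in a common orthonormal basis. The *matrix interval* $\mathcal D_C$ is the free spectrahedron in one variable defined by $C=\operatorname{diag}(1,-1)$, i.e. the self-adjoint matrices $Y$ with $-I\preceq Y\preceq I$. Cartesian products are taken level by level. Let $K=(K(n))_{n\ge1}$, $K(n)\subset SM_n(\mathbb F)^g$, be matrix convex and let $X\in K(n)$. A *matrix convex combination* expressing $X$ is $X=\sum_{i=1}^s V_i^*X^{(i)}V_i$ with $X^{(i)}\in K(n_i)$, $n_i\ge1$,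 $V_i\in M_{n_i,n}(\mathbb F)$ and $\sum_i V_i^*V_i=I_n$; it is *proper* if all $V_i$ are surjective. Unitary equivalence of tuples is simultaneous and over $\mathbb F$. * $X$ is *Euclidean extreme* if it is an extreme point of the convex set $K(n)$. * $X$ is *matrix extreme* if in every proper matrix convex combination expressing $X$, all $n_i=n$ and all $X^{(i)}$ are unitarily equivalent to $X$. * $X$ is *Arveson extreme* if $\begin{pmatrix}X&\beta\\ \beta^*&\gamma\end{pmatrix}\in K(n+m)$ implies $\beta=0$. * $X$ is *free extreme* if in every matrix convex combination expressing $X$ with all $V_i\neq0$, for each $i$ either $n_i=n$ and $X^{(i)}$ is unitarily equivalent to $X$, or $n_i>n$ and $X^{(i)}$ is unitarily equivalent to $X\oplus Z^{(i)}$ for some $Z^{(i)}\in K$. **Theorem.** Let $\mathcal D_S$ be a free simplex and let $\mathcal D_C$ be the matrix interval, both over $\mathbb C$. Let $X\in\mathcal D_S(2)$ be a tuple of real matrices that is a Euclidean extreme point of $\mathcal D_S$ but not an Arveson extreme point of $\mathcal D_S$. Let $Y\in\mathcal D_C(2)$ be an Arveson extreme point of $\mathcal D_C$ whose (entrywise)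 imaginary part is nonzero. Then: 1. $(X,Y)$ is a matrix extreme point of $\mathcal D_S\times\mathcal D_C$, and it is not a free extreme point of $\mathcal D_S\times\mathcal D_C$. 2. Let $Y_{\mathbb R}$ and $Y_{\mathbb C}$ be the real and imaginary parts of $Y$, so that $Y=Y_{\mathbb R}+iY_{\mathbb C}$. The tuple $$\left(\begin{pmatrix}X&0\\0&X\end{pmatrix},\begin{pmatrix}Y_{\mathbb R}&Y_{\mathbb C}\\Y_{\mathbb C}^T&Y_{\mathbb R}\end{pmatrix}\right)$$ belongs to $(\mathcal D_S^{\mathbb R}\times\mathcal D_C^{\mathbb R})(4)$, but it is never a matrix extreme point of the real free spectrahedron $\mathcal D_S^{\mathbb R}\times\mathcal D_C^{\mathbb R}$. -/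

import Mathlib

open scoped Kronecker ComplexOrder Matrix

noncomputable section

/-- A graded set of tuples of matrices indexed by `ι`: for every `n`, a set of tuples of `n × n`
matrices over `𝕜`. The levels of interest are those with `n ≥ 1`. -/
abbrev GradedSet (𝕜 : Type) (ι : Type) : Type :=
  (n : ℕ) → Set (ι → Matrix (Fin n) (Fin n) 𝕜)

/-- The block matrix with rows `(A, B)` and `(C, D)`, with index set `Fin (m + n)`. -/
def blockMat {𝕜 : Type} {m n : ℕ} (A : Matrix (Fin m) (Fin m) 𝕜) (B : Matrix (Fin m) (Fin n) 𝕜)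
    (C : Matrix (Fin n) (Fin m) 𝕜) (D : Matrix (Fin n) (Fin n) 𝕜) :
    Matrix (Fin (m + n)) (Fin (m + n)) 𝕜 :=
  Matrix.reindex finSumFinEquiv finSumFinEquiv (Matrix.fromBlocks A B C D)

/-- Simultaneous unitary equivalence of two tuples (orthogonal equivalence if `𝕜 = ℝ`). The matrix
`U` has a two-sided inverse, so that the two sizes `m` and `n` agree whenever this holds. -/
def UnitarilyEquivalent {𝕜 : Type} [RCLike 𝕜] {ι : Type} {m n : ℕ}
    (X : ι → Matrix (Fin m) (Fin m) 𝕜) (Y : ι → Matrix (Fin n) (Fin n) 𝕜) : Prop :=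
  ∃ U : Matrix (Fin n) (Fin m) 𝕜, U * Uᴴ = 1 ∧ Uᴴ * U = 1 ∧ ∀ j, U * X j * Uᴴ = Y j

/-- `X` is the matrix convex combination of the tuples `P i`, which have sizes `k i ≥ 1`, with
coefficient matrices `V i`. -/
structure IsMatrixConvexCombination {𝕜 : Type} [RCLike 𝕜] {ι : Type} {n s : ℕ}
    (X : ι → Matrix (Fin n) (Fin n) 𝕜) (k : Fin s → ℕ)
    (P : (i : Fin s) → ι → Matrix (Fin (k i)) (Fin (k i)) 𝕜)
    (V : (i : Fin s) → Matrix (Fin (k i)) (Fin n) 𝕜) : Prop where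
  size_pos : ∀ i, 0 < k i
  sum_eq_one : ∑ i, (V i)ᴴ * V i = 1
  eq_sum : ∀ j, X j = ∑ i, (V i)ᴴ * P i j * V i

/-- Euclidean extreme points: extreme points of the set at level `n`. -/
def IsEuclideanExtreme {ι : Type} (K : GradedSet ℂ ι) {n : ℕ}
    (X : ι → Matrix (Fin n) (Fin n) ℂ) : Prop :=
  X ∈ Set.extremePoints ℝ (K n)

/-- Matrix extreme points: in every expression of `X` as a proper matrix convex combination
(all coefficients `V i` surjective) of points of `K`, all these points are unitarily equivalent
to `X` (in particular, of the same size). -/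
def IsMatrixExtreme {𝕜 : Type} [RCLike 𝕜] {ι : Type} (K : GradedSet 𝕜 ι) {n : ℕ}
    (X : ι → Matrix (Fin n) (Fin n) 𝕜) : Prop :=
  X ∈ K n ∧
    ∀ (s : ℕ) (k : Fin s → ℕ) (P : (i : Fin s) → ι → Matrix (Fin (k i)) (Fin (k i)) 𝕜)
      (V : (i : Fin s) → Matrix (Fin (k i)) (Fin n) 𝕜),
      (∀ i, P i ∈ K (k i)) → IsMatrixConvexCombination X k P V →
      (∀ i, Function.Surjective (V i).mulVec) →
      ∀ i, k i = n ∧ UnitarilyEquivalent (P i) X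

/-- Arveson extreme points: every dilation of `X` in `K` is trivial. -/
def IsArvesonExtreme {𝕜 : Type} [RCLike 𝕜] {ι : Type} (K : GradedSet 𝕜 ι) {n : ℕ}
    (X : ι → Matrix (Fin n) (Fin n) 𝕜) : Prop :=
  X ∈ K n ∧
    ∀ (m : ℕ) (β : ι → Matrix (Fin n) (Fin m) 𝕜) (γ : ι → Matrix (Fin m) (Fin m) 𝕜),
      (fun j => blockMat (X j) (β j) (β j)ᴴ (γ j)) ∈ K (n + m) → ∀ j, β j = 0

/-- Free (or absolute) extreme points: in every expression of `X` as a matrix convex combination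
with nonzero coefficients of points of `K`, each of these points is unitarily equivalent to `X`, or
is larger than `X` and unitarily equivalent to `X ⊕ Z` for some `Z` in `K`. -/
def IsFreeExtreme {𝕜 : Type} [RCLike 𝕜] {ι : Type} (K : GradedSet 𝕜 ι) {n : ℕ}
    (X : ι → Matrix (Fin n) (Fin n) 𝕜) : Prop :=
  X ∈ K n ∧
    ∀ (s : ℕ) (k : Fin s → ℕ) (P : (i : Fin s) → ι → Matrix (Fin (k i)) (Fin (k i)) 𝕜)
      (V : (i : Fin s) → Matrix (Fin (k i)) (Fin n) 𝕜),
      (∀ i, P i ∈ K (k i)) → IsMatrixConvexCombination X k P V →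
      (∀ i, V i ≠ 0) →
      ∀ i, (k i = n ∧ UnitarilyEquivalent (P i) X) ∨
        (n < k i ∧ ∃ (m : ℕ) (Z : ι → Matrix (Fin m) (Fin m) 𝕜), Z ∈ K m ∧
          UnitarilyEquivalent (P i) (fun j => blockMat (X j) 0 0 (Z j)))

/-- The free spectrahedron defined by the tuple `A`: at level `n`, the tuples `X` of self-adjoint
`n × n` matrices with `I - ∑ i, A i ⊗ X i` positive semidefinite. -/
def freeSpectrahedron {𝕜 : Type} [RCLike 𝕜] {g d : ℕ} (A : Fin g → Matrix (Fin d) (Fin d) 𝕜) :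
    GradedSet 𝕜 (Fin g) :=
  fun _ => {X | (∀ i, (X i).IsHermitian) ∧ (1 - ∑ i, A i ⊗ₖ X i).PosSemidef}

/-- A graded set is bounded if each of its levels is. -/
def GradedSet.IsBounded {𝕜 : Type} [RCLike 𝕜] {ι : Type} (K : GradedSet 𝕜 ι) : Prop :=
  ∀ n, ∃ R : ℝ, ∀ X ∈ K n, ∀ i a b, ‖X i a b‖ ≤ R

/-- `S` is a defining tuple of a free simplex in `g` variables: self-adjoint matrices of size
`g + 1`, diagonal in a common orthonormal basis, whose free spectrahedron is bounded. -/
structure DefinesFreeSimplex {g : ℕ} (S : Fin g → Matrix (Fin (g + 1)) (Fin (g + 1)) ℂ) :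
    Prop where
  isHermitian : ∀ i, (S i).IsHermitian
  simultaneously_diagonal :
    ∃ U ∈ Matrix.unitaryGroup (Fin (g + 1)) ℂ, ∀ i, (Uᴴ * S i * U).IsDiag
  bounded : (freeSpectrahedron S).IsBounded

/-- The matrix interval: the free spectrahedron in one variable defined by `diag (1, -1)`, that is
the self-adjoint matrices `Y` with `-I ≤ Y ≤ I`. -/
def matrixInterval (𝕜 : Type) [RCLike 𝕜] : GradedSet 𝕜 (Fin 1) :=
  freeSpectrahedron (fun _ => Matrix.diagonal ![(1 : 𝕜), -1])

/-- The Cartesian product of graded sets, taken level by level; a pair `(X, Y)` is the tuple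
`Sum.elim X Y`. -/
def GradedSet.prod {𝕜 : Type} {ι κ : Type} (K : GradedSet 𝕜 ι) (L : GradedSet 𝕜 κ) :
    GradedSet 𝕜 (ι ⊕ κ) :=
  fun n => {Z | (fun i => Z (Sum.inl i)) ∈ K n ∧ (fun j => Z (Sum.inr j)) ∈ L n}

/-- A tuple of real matrices, viewed as a tuple of complex matrices. -/
def complexify {ι : Type} {n : ℕ} (X : ι → Matrix (Fin n) (Fin n) ℝ) :
    ι → Matrix (Fin n) (Fin n) ℂ :=
  fun i => (X i).map Complex.ofReal

/-- The real part `K ∩ SM(ℝ)^ι` of a complex graded set `K`. For a free spectrahedron this is the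
associated real free spectrahedron, see `realPart_freeSpectrahedron`. -/
def GradedSet.realPart {ι : Type} (K : GradedSet ℂ ι) : GradedSet ℝ ι :=
  fun n => {X | complexify X ∈ K n}

open scoped MatrixOrder in
theorem posSemidef_map_ofReal_iff {m : Type} [Fintype m] (M : Matrix m m ℝ) :
    (M.map Complex.ofReal).PosSemidef ↔ M.PosSemidef := by
  classical
  have hstar : ∀ N : Matrix m m ℝ, (N.map Complex.ofReal)ᴴ = Nᴴ.map Complex.ofReal := by
    intro N
    ext a b
    simp [Matrix.conjTranspose_apply]
  constructor
  · intro h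
    refine Matrix.PosSemidef.of_dotProduct_mulVec_nonneg ?_ fun x => ?_
    · refine Matrix.map_injective Complex.ofReal_injective ?_
      change Mᴴ.map Complex.ofReal = M.map Complex.ofReal
      rw [← hstar]
      exact h.1
    · have h2 := h.dotProduct_mulVec_nonneg (fun i => (x i : ℂ))
      have h3 : star (fun i => (x i : ℂ)) ⬝ᵥ (M.map Complex.ofReal *ᵥ fun i => (x i : ℂ)) =
          ((star x ⬝ᵥ (M *ᵥ x) : ℝ) : ℂ) := by
        simp [dotProduct, Matrix.mulVec]
      rw [h3] at h2
      exact_mod_cast h2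
  · intro h
    obtain ⟨B, rfl⟩ := CStarAlgebra.nonneg_iff_eq_star_mul_self.mp h.nonneg
    rw [Matrix.star_eq_conjTranspose]
    have h1 : (Bᴴ * B).map Complex.ofReal =
        (B.map Complex.ofReal)ᴴ * B.map Complex.ofReal := by
      rw [hstar]
      exact Matrix.map_mul (f := Complex.ofRealHom)
    rw [h1]
    exact Matrix.posSemidef_conjTranspose_mul_self _

theorem realPart_freeSpectrahedron {g d : ℕ} (A : Fin g → Matrix (Fin d) (Fin d) ℝ) :
    (freeSpectrahedron (complexify A)).realPart = freeSpectrahedron A := by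
  funext n
  ext X
  have h1 : (1 - ∑ i, complexify A i ⊗ₖ complexify X i) =
      (1 - ∑ i, A i ⊗ₖ X i).map Complex.ofReal := by
    ext a b
    simp [complexify, Matrix.sub_apply, Matrix.sum_apply, Matrix.one_apply, apply_ite Complex.ofReal]
  have h2 : ∀ i, (complexify X i).IsHermitian ↔ (X i).IsHermitian := by
    intro i
    simp only [Matrix.IsHermitian, ← Matrix.ext_iff, complexify, Matrix.conjTranspose_apply,
      Matrix.map_apply]
    simp
  change ((∀ i, (complexify X i).IsHermitian) ∧ _) ↔ ((∀ i, (X i).IsHermitian) ∧ _)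
  rw [h1, posSemidef_map_ofReal_iff]
  simp only [h2]

end

open scoped Kronecker ComplexOrder Matrix

noncomputable section

/-! Boundedness makes the g + 1 scalar inequalities of a free simplex cut out a genuine simplex. In
barycentric coordinates a point X of level n is therefore the same thing as a resolution of the
identity: matrices T_j ≥ 0 with ∑ T_j = 1. If all T_j are projections, X is Arveson extreme. If X is
Euclidean extreme and the T_j commute, moving mass between two of them forces T_j T_k = 0, so they
are projections. Hence the given X has non-commuting T_j (`exists_bary_not_commute`). At size 2 the
same exchange of mass shows that every T_j is singular (`det_bary_eq_zero`). An Arveson extreme Y of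
the interval satisfies Y² = 1.

Matrix extremality. In a proper combination, Y² = 1 forces V_i Y = P_i V_i on the interval
component, so G = V_i* V_i commutes with Y. On the simplex component, G is a sum of matrices Q_j
with 0 ≤ Q_j ≤ T_j. As T_j is real and singular, Q_j kills a nonzero real vector, so its
off-diagonal entries are real. Thus G is real, and since it commutes with the non-real Y it is a
scalar. So V_i is a multiple of a unitary, and Euclidean extremality of X identifies the point.

Failure of free extremality. A Naimark dilation writes X as V* Z V with V isometric and Z commuting,
and Y = V*(V Y V*)V. Free extremality would make X a summand of Z up to unitary equivalence, so X
would commute.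

Failure over the reals. Choose a real reflection F that commutes with Re Y; it anticommutes with Im
Y, a multiple of the rotation by a right angle. The T_j span the real symmetric matrices, so F = ∑
f_j T_j. With S_q = p + qF and p² + q² = 1/2 one has S_q² = ∑ ½(1 + 4pq f_j) T_j, so the matrices
½(1 + 4pq f_j) S_q⁻¹ T_j S_q⁻¹ resolve the identity and define a point X_q. The weights S_q ⊕ S_{-q}
and S_{-q} ⊕ S_q commute with the realification of Y and express the given tuple through X_q ⊕
X_{-q} and X_{-q} ⊕ X_q. Were X_q ⊕ X_{-q} orthogonally equivalent to X ⊕ X, comparing traces would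
make every T_j commute with F, hence the T_j with each other. -/

/-- The linear pencil `1 - ∑ i, a i • X i` with real scalar coefficients `a`. -/
def slack {𝕜 : Type} [RCLike 𝕜] {g n : ℕ} (a : Fin g → ℝ) (X : Fin g → Matrix (Fin n) (Fin n) 𝕜) :
    Matrix (Fin n) (Fin n) 𝕜 :=
  1 - ∑ i, a i • X i

/-! ### Diagonal pencils as systems of scalar-coefficient inequalities -/

theorem one_sub_sum_diagonal_kronecker {𝕜 : Type} [RCLike 𝕜] {g d n : ℕ} (D : Fin d → Fin g → ℝ)
    (X : Fin g → Matrix (Fin n) (Fin n) 𝕜) :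
    1 - ∑ i, Matrix.diagonal (fun k => ((D k i : ℝ) : 𝕜)) ⊗ₖ X i =
      ∑ j, Matrix.diagonal (Pi.single j (1 : 𝕜)) ⊗ₖ slack (D j) X := by
  ext ⟨j, p⟩ ⟨k, q⟩
  simp only [Matrix.sub_apply, Matrix.sum_apply, Matrix.kroneckerMap_apply, Matrix.diagonal_apply,
    slack, Matrix.smul_apply, Matrix.one_apply, Prod.mk.injEq]
  by_cases hjk : j = k
  · subst hjk
    simp only [if_true, true_and, Pi.single_apply, ite_mul, one_mul, zero_mul, RCLike.real_smul_eq_coe_mul]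
    simp
  · simp [hjk]

theorem posSemidef_one_sub_sum_diagonal_kronecker_iff {𝕜 : Type} [RCLike 𝕜] {g d n : ℕ}
    (D : Fin d → Fin g → ℝ) (X : Fin g → Matrix (Fin n) (Fin n) 𝕜) :
    (1 - ∑ i, Matrix.diagonal (fun k => ((D k i : ℝ) : 𝕜)) ⊗ₖ X i).PosSemidef ↔
      ∀ j, (slack (D j) X).PosSemidef := by
  rw [one_sub_sum_diagonal_kronecker]
  constructor
  · intro h j
    have := h.submatrix (fun p : Fin n => (j, p))
    convert this using 1
    ext p q
    simp [Matrix.sum_apply, Pi.single_apply]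
  · intro h
    refine Matrix.posSemidef_sum _ fun j _ => ?_
    refine Matrix.PosSemidef.kronecker (Matrix.PosSemidef.diagonal ?_) (h j)
    intro k
    by_cases hk : k = j
    · subst hk; simp
    · simp [hk]

theorem mem_matrixInterval_iff {𝕜 : Type} [RCLike 𝕜] {n : ℕ}
    (Y : Fin 1 → Matrix (Fin n) (Fin n) 𝕜) :
    Y ∈ matrixInterval 𝕜 n ↔
      (Y 0).IsHermitian ∧ (1 - Y 0).PosSemidef ∧ (1 + Y 0).PosSemidef := by
  have h := posSemidef_one_sub_sum_diagonal_kronecker_iff (𝕜 := 𝕜)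
    (fun k (_ : Fin 1) => (![1, -1] : Fin 2 → ℝ) k) Y
  have h1 : (fun k => (((![1, -1] : Fin 2 → ℝ) k : ℝ) : 𝕜)) = ![1, -1] := by
    funext k; fin_cases k <;> simp
  simp only [h1] at h
  change ((∀ i, (Y i).IsHermitian) ∧
    (1 - ∑ i : Fin 1, Matrix.diagonal ![(1 : 𝕜), -1] ⊗ₖ Y i).PosSemidef) ↔ _
  rw [h, Fin.forall_fin_two]
  simp [slack, Fin.forall_fin_one]

/-- Conjugation by U ⊗ 1 makes the pencil block diagonal; `a j` collects the j-th joint eigenvalues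
of `S`, which are real because each `S i` is self-adjoint. -/
theorem DefinesFreeSimplex.exists_slack {g : ℕ} {S : Fin g → Matrix (Fin (g + 1)) (Fin (g + 1)) ℂ}
    (hS : DefinesFreeSimplex S) :
    ∃ a : Fin (g + 1) → Fin g → ℝ, ∀ (n : ℕ) (X : Fin g → Matrix (Fin n) (Fin n) ℂ),
      X ∈ freeSpectrahedron S n ↔ (∀ i, (X i).IsHermitian) ∧ ∀ j, (slack (a j) X).PosSemidef := by
  obtain ⟨U, hU, hD⟩ := hS.simultaneously_diagonal
  rw [Matrix.mem_unitaryGroup_iff'] at hU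
  rw [Matrix.star_eq_conjTranspose] at hU
  refine ⟨fun j i => ((Uᴴ * S i * U) j j).re, fun n X => and_congr_right fun _ => ?_⟩
  rw [← posSemidef_one_sub_sum_diagonal_kronecker_iff]
  have hdiag : ∀ i, Matrix.diagonal (fun k => ((((Uᴴ * S i * U) k k).re : ℝ) : ℂ)) =
      Uᴴ * S i * U := by
    intro i
    have hh : (Uᴴ * S i * U).IsHermitian := Matrix.isHermitian_conjTranspose_mul_mul _ (hS.isHermitian i)
    ext p q
    by_cases hpq : p = q
    · subst hpq
      rw [Matrix.diagonal_apply_eq]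
      exact Complex.conj_eq_iff_re.mp (hh.apply p p)
    · rw [Matrix.diagonal_apply_ne _ hpq, hD i hpq]
  have hone : (U ⊗ₖ (1 : Matrix (Fin n) (Fin n) ℂ))ᴴ * (U ⊗ₖ (1 : Matrix (Fin n) (Fin n) ℂ)) = 1 := by
    rw [Matrix.conjTranspose_kronecker, ← Matrix.mul_kronecker_mul, hU]
    simp
  have hunit : IsUnit (U ⊗ₖ (1 : Matrix (Fin n) (Fin n) ℂ)) :=
    (Matrix.isUnit_iff_isUnit_det _).mpr (Matrix.isUnit_det_of_left_inverse hone)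
  rw [← Matrix.IsUnit.posSemidef_star_left_conjugate_iff hunit, Matrix.star_eq_conjTranspose]
  have : (U ⊗ₖ (1 : Matrix (Fin n) (Fin n) ℂ))ᴴ * (1 - ∑ i, S i ⊗ₖ X i) *
      (U ⊗ₖ (1 : Matrix (Fin n) (Fin n) ℂ)) =
      1 - ∑ i, Matrix.diagonal (fun k => ((((Uᴴ * S i * U) k k).re : ℝ) : ℂ)) ⊗ₖ X i := by
    rw [Matrix.mul_sub, Matrix.sub_mul, Matrix.mul_one, hone, Matrix.mul_sum, Matrix.sum_mul]
    congr 1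
    refine Finset.sum_congr rfl fun i _ => ?_
    rw [hdiag, Matrix.conjTranspose_kronecker, ← Matrix.mul_kronecker_mul,
      ← Matrix.mul_kronecker_mul]
    simp
  rw [this]
  exact Iff.rfl

/-! ### Vertices and barycentric coordinates of a bounded simplex -/

/-- `x j` are the vertices of the simplex cut out by the inequalities `∑ i, a j i * t i ≤ 1`, and
`c j * (1 - ∑ i, a j i * t i)` are its barycentric coordinates. -/
structure IsSimplexFrame {g : ℕ} (a : Fin (g + 1) → Fin g → ℝ) (c : Fin (g + 1) → ℝ)
    (x : Fin (g + 1) → Fin g → ℝ) : Prop where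
  pos : ∀ j, 0 < c j
  dual : ∀ k j, c k * (1 - ∑ i, a k i * x j i) = if k = j then 1 else 0
  sum_c : ∑ j, c j = 1
  sum_ca : ∀ i, ∑ j, c j * a j i = 0
  sum_cx : ∀ i, ∑ j, c j * x j i = 0
  sum_cxa : ∀ i l, ∑ j, c j * x j i * a j l = if i = l then -1 else 0

theorem exists_simplexFrame {g : ℕ} (a : Fin (g + 1) → Fin g → ℝ)
    (h : ∀ d : Fin g → ℝ, (∀ j, ∑ i, a j i * d i ≤ 0) → d = 0) :
    ∃ c x, IsSimplexFrame a c x := by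
  classical
  -- Row j of `A` is (1, -a_j), the homogenised j-th inequality. Column j of its inverse will be c_j
  -- (1, x_j), so the frame identities are the entries of A A⁻¹ = 1 and A⁻¹ A = 1.
  set A : Matrix (Fin (g + 1)) (Fin (g + 1)) ℝ :=
    Matrix.of fun j => Fin.cons 1 (fun i => - a j i) with hA
  have hmul : ∀ (v : Fin (g + 1) → ℝ) j, (A *ᵥ v) j = v 0 - ∑ i, a j i * v i.succ := by
    intro v j
    simp [hA, Matrix.mulVec, dotProduct, Fin.sum_univ_succ, sub_eq_add_neg]
  have hneg : ∀ v : Fin (g + 1) → ℝ, v 0 ≤ 0 → (∀ j, 0 ≤ (A *ᵥ v) j) → ∀ i : Fin g, v i.succ = 0 := by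
    intro v h0 hv i
    have := h (fun i => v i.succ) (fun j => by have := hv j; rw [hmul] at this; linarith)
    exact congrFun this i
  have hker : ∀ v : Fin (g + 1) → ℝ, v 0 ≤ 0 → A *ᵥ v = 0 → v = 0 := by
    intro v h0 hv
    have h1 := hneg v h0 (fun j => by rw [hv]; simp)
    have h2 := hmul v 0
    rw [hv] at h2
    simp [h1] at h2
    funext i
    refine Fin.cases ?_ (fun i => ?_) i
    · exact h2.symm
    · exact h1 i
  have hinj : A.det ≠ 0 := by
    intro hdet
    obtain ⟨v, hv0, hv⟩ := Matrix.exists_mulVec_eq_zero_iff.mpr hdet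
    rcases le_total (v 0) 0 with h0 | h0
    · exact hv0 (hker v h0 hv)
    · refine hv0 (neg_eq_zero.mp (hker (-v) (by simpa using h0) ?_))
      rw [Matrix.mulVec_neg, hv, neg_zero]
  have hu : IsUnit A.det := isUnit_iff_ne_zero.mpr hinj
  have h1 : A * A⁻¹ = 1 := Matrix.mul_nonsing_inv A hu
  have h2 : A⁻¹ * A = 1 := Matrix.nonsing_inv_mul A hu
  have hcol : ∀ k j, A⁻¹ 0 j - ∑ i, a k i * A⁻¹ i.succ j = if k = j then 1 else 0 := by
    intro k j
    have := congrFun (congrFun h1 k) j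
    rw [Matrix.one_apply] at this
    rw [← this, Matrix.mul_apply, Fin.sum_univ_succ]
    simp [hA, sub_eq_add_neg]
  -- If the top entry of column j were nonpositive, then A times that column, which is e_j ≥ 0,
  -- would make its lower part a recession direction, hence zero; the top entry would then be 1.
  have hpos : ∀ j, 0 < A⁻¹ 0 j := by
    intro j
    by_contra hle
    push Not at hle
    have h3 := hneg (fun i => A⁻¹ i j) hle (fun k => by
      rw [hmul, hcol]; split_ifs <;> norm_num)
    have h4 := hcol j j
    simp [h3] at h4
    linarith
  have hrow : ∀ i l, ∑ j, A⁻¹ i j * A j l = if i = l then 1 else 0 := by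
    intro i l
    rw [← Matrix.one_apply, ← h2, Matrix.mul_apply]
  have hne := fun j => (hpos j).ne'
  have hcx : ∀ j i, A⁻¹ 0 j * (A⁻¹ (Fin.succ i) j / A⁻¹ 0 j) = A⁻¹ (Fin.succ i) j := by
    intro j i
    field_simp [hne j]
  refine ⟨fun j => A⁻¹ 0 j, fun j i => A⁻¹ i.succ j / A⁻¹ 0 j, hpos, ?_, ?_, ?_, ?_, ?_⟩
  · intro k j
    have h5 : ∑ i, a k i * (A⁻¹ (Fin.succ i) j / A⁻¹ 0 j) =
        (∑ i, a k i * A⁻¹ (Fin.succ i) j) / A⁻¹ 0 j := by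
      rw [Finset.sum_div]
      exact Finset.sum_congr rfl fun i _ => by ring
    have h6 := hcol k j
    rw [h5]
    by_cases hkj : k = j
    · subst hkj
      have := hne k
      simp only [if_true] at h6 ⊢
      field_simp
      linarith
    · simp only [hkj, if_false] at h6 ⊢
      have h7 : ∑ i, a k i * A⁻¹ (Fin.succ i) j = A⁻¹ 0 j := by linarith
      rw [h7, div_self (hne j)]
      simp
  · have := hrow 0 0
    simpa [hA] using this
  · intro i
    have := hrow 0 i.succ
    rw [if_neg (Fin.succ_ne_zero i).symm] at this
    simpa [hA] using this
  · intro i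
    have := hrow i.succ 0
    rw [if_neg (Fin.succ_ne_zero i)] at this
    simp only [hcx]
    simpa [hA] using this
  · intro i l
    have := hrow i.succ l.succ
    simp only [hcx]
    simp only [Fin.succ_inj] at this
    simp only [hA, Matrix.of_apply, Fin.cons_succ, mul_neg, Finset.sum_neg_distrib] at this
    rw [neg_eq_iff_eq_neg] at this
    rw [hA, this]
    split_ifs <;> simp

/-- A direction along which no constraint increases gives a whole ray in level 1, against
boundedness. -/
theorem eq_zero_of_forall_slack_nonpos {g : ℕ} {S : Fin g → Matrix (Fin (g + 1)) (Fin (g + 1)) ℂ}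
    (hS : DefinesFreeSimplex S) {a : Fin (g + 1) → Fin g → ℝ}
    (ha : ∀ (n : ℕ) (X : Fin g → Matrix (Fin n) (Fin n) ℂ),
      X ∈ freeSpectrahedron S n ↔ (∀ i, (X i).IsHermitian) ∧ ∀ j, (slack (a j) X).PosSemidef)
    (d : Fin g → ℝ) (hd : ∀ j, ∑ i, a j i * d i ≤ 0) : d = 0 := by
  obtain ⟨R, hR⟩ := hS.bounded 1
  have hmem : ∀ s : ℝ, 0 ≤ s →
      (fun i => ((s * d i : ℝ) : ℂ) • (1 : Matrix (Fin 1) (Fin 1) ℂ)) ∈ freeSpectrahedron S 1 := by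
    intro s hs
    rw [ha]
    refine ⟨fun i => ?_, fun j => ?_⟩
    · rw [Matrix.IsHermitian, Matrix.conjTranspose_smul]
      simp
    · have : slack (a j) (fun i => ((s * d i : ℝ) : ℂ) • (1 : Matrix (Fin 1) (Fin 1) ℂ)) =
          ((1 - s * ∑ i, a j i * d i : ℝ) : ℂ) • 1 := by
        ext p q
        fin_cases p; fin_cases q
        simp [slack, Matrix.sum_apply, Finset.mul_sum]
        exact Finset.sum_congr rfl fun i _ => by ring
      rw [this]
      refine Matrix.PosSemidef.one.smul ?_
      have := mul_nonpos_of_nonneg_of_nonpos hs (hd j)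
      exact_mod_cast (by linarith : (0 : ℝ) ≤ 1 - s * ∑ i, a j i * d i)
  funext i
  by_contra hne
  have hpos : 0 < |d i| := abs_pos.mpr hne
  have := hR _ (hmem ((|R| + 1) / |d i|) (by positivity)) i 0 0
  simp only [Matrix.smul_apply, Matrix.one_apply_eq, smul_eq_mul, mul_one, Complex.norm_real,
    Real.norm_eq_abs, abs_mul, abs_div, abs_abs] at this
  rw [div_mul_cancel₀ _ hpos.ne', abs_of_pos (by positivity : (0 : ℝ) < |R| + 1)] at this
  linarith [le_abs_self R]

/-! ### Kernels of positive semidefinite matrices -/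

theorem Matrix.PosSemidef.mul_eq_zero_of_conjTranspose_mul_mul_eq_zero {𝕜 : Type} [RCLike 𝕜]
    {m n : Type} [Fintype m] [Fintype n] {M : Matrix m m 𝕜} (hM : M.PosSemidef)
    {C : Matrix m n 𝕜} (h : Cᴴ * M * C = 0) : M * C = 0 := by
  classical
  open scoped MatrixOrder in
  obtain ⟨B, rfl⟩ := CStarAlgebra.nonneg_iff_eq_star_mul_self.mp hM.nonneg
  rw [Matrix.star_eq_conjTranspose] at *
  have h1 : (B * C)ᴴ * (B * C) = 0 := by
    rw [Matrix.conjTranspose_mul, ← h]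
    simp only [Matrix.mul_assoc]
  rw [Matrix.conjTranspose_mul_self_eq_zero] at h1
  rw [Matrix.mul_assoc, h1, Matrix.mul_zero]

/-- The quadratic form of the block matrix vanishes on the columns of `C` padded with zeros, so the
whole block matrix annihilates them. -/
theorem Matrix.PosSemidef.conjTranspose_mul_eq_zero_of_fromBlocks {𝕜 : Type} [RCLike 𝕜]
    {m n l : Type} [Fintype m] [Fintype n] [Fintype l] {P : Matrix n n 𝕜} {B : Matrix n m 𝕜}
    {B' : Matrix m n 𝕜} {G : Matrix m m 𝕜} (hM : (Matrix.fromBlocks P B B' G).PosSemidef)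
    {C : Matrix n l 𝕜} (h : P * C = 0) : B' * C = 0 := by
  have h1 := hM.mul_eq_zero_of_conjTranspose_mul_mul_eq_zero (C := Matrix.fromRows C 0) (by
    rw [Matrix.mul_assoc, Matrix.fromBlocks_mul_fromRows, h,
      Matrix.conjTranspose_fromRows_eq_fromCols_conjTranspose, Matrix.fromCols_mul_fromRows]
    simp)
  rw [Matrix.fromBlocks_mul_fromRows, ← Matrix.fromRows_zero] at h1
  have := (Matrix.fromRows_inj h1).2
  simpa using this

/-! ### Free simplices as resolutions of the identity -/

section bary

variable {𝕜 : Type} [RCLike 𝕜] {g n : ℕ} {a : Fin (g + 1) → Fin g → ℝ} {c : Fin (g + 1) → ℝ}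
  {x : Fin (g + 1) → Fin g → ℝ}

/-- The operator-valued barycentric coordinates of a tuple. -/
def bary (a : Fin (g + 1) → Fin g → ℝ) (c : Fin (g + 1) → ℝ)
    (X : Fin g → Matrix (Fin n) (Fin n) 𝕜) (j : Fin (g + 1)) : Matrix (Fin n) (Fin n) 𝕜 :=
  c j • slack (a j) X

/-- The tuple with operator-valued barycentric coordinates `B`. -/
def ofBary (x : Fin (g + 1) → Fin g → ℝ) (B : Fin (g + 1) → Matrix (Fin n) (Fin n) 𝕜) (i : Fin g) :
    Matrix (Fin n) (Fin n) 𝕜 :=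
  ∑ j, x j i • B j

theorem IsSimplexFrame.smul_sub_ofBary (hf : IsSimplexFrame a c x)
    (B : Fin (g + 1) → Matrix (Fin n) (Fin n) 𝕜) (k : Fin (g + 1)) :
    c k • (∑ j, B j - ∑ i, a k i • ofBary x B i) = B k := by
  have h : ∀ j, c k • B j - ∑ i, c k • (a k i • (x j i • B j)) = if k = j then B j else 0 := by
    intro j
    have := congrArg (fun r : ℝ => r • B j) (hf.dual k j)
    simp only [mul_sub, mul_one, Finset.mul_sum, sub_smul, Finset.sum_smul, ite_smul, one_smul,
      zero_smul, mul_smul] at this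
    exact this
  simp only [ofBary, smul_sub, Finset.smul_sum]
  rw [Finset.sum_comm, ← Finset.sum_sub_distrib, Finset.sum_congr rfl fun j _ => h j]
  simp

theorem IsSimplexFrame.bary_ofBary (hf : IsSimplexFrame a c x)
    {B : Fin (g + 1) → Matrix (Fin n) (Fin n) 𝕜} (hB : ∑ j, B j = 1) (k : Fin (g + 1)) :
    bary a c (ofBary x B) k = B k := by
  rw [bary, slack, ← hB, hf.smul_sub_ofBary]

theorem IsSimplexFrame.sum_bary (hf : IsSimplexFrame a c x)
    (X : Fin g → Matrix (Fin n) (Fin n) 𝕜) : ∑ j, bary a c X j = 1 := by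
  simp only [bary, slack, smul_sub, Finset.sum_sub_distrib, Finset.smul_sum]
  rw [← Finset.sum_smul, hf.sum_c, one_smul, Finset.sum_comm]
  simp only [← mul_smul, ← Finset.sum_smul, hf.sum_ca]
  simp

theorem IsSimplexFrame.ofBary_bary (hf : IsSimplexFrame a c x)
    (X : Fin g → Matrix (Fin n) (Fin n) 𝕜) : ofBary x (bary a c X) = X := by
  funext l
  simp only [ofBary, bary, slack, smul_sub, Finset.sum_sub_distrib, Finset.smul_sum]
  rw [Finset.sum_comm]
  simp only [← mul_smul, ← Finset.sum_smul]
  have h1 : ∑ j, x j l * c j = 0 := by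
    rw [← hf.sum_cx l]; exact Finset.sum_congr rfl fun j _ => mul_comm _ _
  have h2 : ∀ i, ∑ j, x j l * c j * a j i = if l = i then -1 else 0 := by
    intro i
    rw [← hf.sum_cxa l i]; exact Finset.sum_congr rfl fun j _ => by ring
  simp only [← mul_assoc, h1, h2]
  simp

/-- Compression of the affine coordinate by an arbitrary `V` turns the constant 1 into V* V. This
serves both for summing over a convex combination and for conjugation by coisometries. -/
theorem bary_smul_sub_sum {m : ℕ} (X : Fin g → Matrix (Fin n) (Fin n) 𝕜)
    (V : Matrix (Fin n) (Fin m) 𝕜) (j : Fin (g + 1)) :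
    Vᴴ * bary a c X j * V = c j • (Vᴴ * V - ∑ i, a j i • (Vᴴ * X i * V)) := by
  simp only [bary, slack, Matrix.mul_smul, Matrix.smul_mul, Matrix.mul_sub, Matrix.sub_mul,
    Matrix.mul_sum, Matrix.sum_mul, Matrix.mul_one]

theorem bary_complexify (X : Fin g → Matrix (Fin n) (Fin n) ℝ) (j : Fin (g + 1)) :
    bary a c (complexify X) j = (bary a c X j).map Complex.ofReal := by
  ext p q
  simp [bary, slack, complexify, Matrix.sum_apply, Matrix.one_apply, apply_ite Complex.ofReal]

theorem submatrix_slack_blockMat {m : ℕ} (b : Fin g → ℝ) (X : Fin g → Matrix (Fin n) (Fin n) 𝕜)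
    (β : Fin g → Matrix (Fin n) (Fin m) 𝕜) (β' : Fin g → Matrix (Fin m) (Fin n) 𝕜)
    (γ : Fin g → Matrix (Fin m) (Fin m) 𝕜) :
    (slack b fun i => blockMat (X i) (β i) (β' i) (γ i)).submatrix finSumFinEquiv finSumFinEquiv =
      Matrix.fromBlocks (slack b X) (-∑ i, b i • β i) (-∑ i, b i • β' i) (slack b γ) := by
  ext p q
  rcases p with p | p <;> rcases q with q | q <;>
    simp [slack, blockMat, Matrix.sum_apply, Matrix.one_apply, Fin.ext_iff] <;> omega

theorem submatrix_bary_blockMat {m : ℕ} (X : Fin g → Matrix (Fin n) (Fin n) 𝕜)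
    (β : Fin g → Matrix (Fin n) (Fin m) 𝕜) (β' : Fin g → Matrix (Fin m) (Fin n) 𝕜)
    (γ : Fin g → Matrix (Fin m) (Fin m) 𝕜) (j : Fin (g + 1)) :
    (bary a c (fun i => blockMat (X i) (β i) (β' i) (γ i)) j).submatrix
        finSumFinEquiv finSumFinEquiv =
      Matrix.fromBlocks (bary a c X j) (-(c j • ∑ i, a j i • β i)) (-(c j • ∑ i, a j i • β' i))
        (bary a c γ j) := by
  rw [bary, Matrix.submatrix_smul, Pi.smul_apply, Pi.smul_apply, submatrix_slack_blockMat, Matrix.fromBlocks_smul]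
  simp only [smul_neg, bary]

/-- `K` is the free simplex with the barycentric coordinates given by `a` and `c`. -/
def IsFreeSimplex (a : Fin (g + 1) → Fin g → ℝ) (c : Fin (g + 1) → ℝ) (K : GradedSet 𝕜 (Fin g)) :
    Prop :=
  ∀ (n : ℕ) (X : Fin g → Matrix (Fin n) (Fin n) 𝕜),
    X ∈ K n ↔ (∀ i, (X i).IsHermitian) ∧ ∀ j, (bary a c X j).PosSemidef

theorem IsFreeSimplex.isArvesonExtreme {K : GradedSet 𝕜 (Fin g)} (hK : IsFreeSimplex a c K)
    (hf : IsSimplexFrame a c x) {X : Fin g → Matrix (Fin n) (Fin n) 𝕜} (hX : X ∈ K n)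
    (hproj : ∀ j, bary a c X j * bary a c X j = bary a c X j) : IsArvesonExtreme K X := by
  refine ⟨hX, fun m β γ hZ => ?_⟩
  rw [hK] at hZ
  have hps := hZ.2
  set Z : Fin g → Matrix (Fin (n + m)) (Fin (n + m)) 𝕜 :=
    fun j => blockMat (X j) (β j) (β j)ᴴ (γ j) with hZdef
  have hzero : ∀ j, c j • ∑ i, a j i • (β i)ᴴ = 0 := by
    intro j
    have h1 := (hps j).submatrix (finSumFinEquiv (m := n) (n := m))
    rw [hZdef, submatrix_bary_blockMat] at h1
    have h2 : (1 - bary a c Z j).PosSemidef := by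
      rw [← hf.sum_bary Z, ← Finset.sum_erase_eq_sub (Finset.mem_univ j)]
      exact Matrix.posSemidef_sum _ fun k _ => hps k
    have h3 := h2.submatrix (finSumFinEquiv (m := n) (n := m))
    rw [Matrix.submatrix_sub, Pi.sub_apply, Pi.sub_apply, hZdef, submatrix_bary_blockMat, Matrix.submatrix_one_equiv, ← Matrix.fromBlocks_one,
      sub_eq_add_neg, Matrix.fromBlocks_neg, Matrix.fromBlocks_add] at h3
    -- For a projection T, the off-diagonal block kills ker T because the coordinate of the dilation
    -- is positive, and kills ker (1 - T) because its complement is too. Together these exhaust the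
    -- space.
    have h4 := h1.conjTranspose_mul_eq_zero_of_fromBlocks (C := 1 - bary a c X j) (by
      rw [mul_sub, hproj]; simp)
    have h5 := h3.conjTranspose_mul_eq_zero_of_fromBlocks (C := bary a c X j) (by
      rw [← sub_eq_add_neg, sub_mul, hproj]; simp)
    rw [Matrix.mul_sub, Matrix.mul_one, sub_eq_zero] at h4
    rw [zero_add, neg_neg] at h5
    rw [Matrix.neg_mul, h5, neg_zero, neg_eq_zero] at h4
    exact h4
  intro l
  -- Weighting by the vertices inverts the passage to coordinates and recovers each β up to sign and
  -- adjoint.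
  have h6 : ∑ j, x j l • (c j • ∑ i, a j i • (β i)ᴴ) = 0 := by simp [hzero]
  simp only [Finset.smul_sum] at h6
  rw [Finset.sum_comm] at h6
  simp only [← mul_smul, ← Finset.sum_smul] at h6
  have h2 : ∀ i, ∑ j, x j l * (c j * a j i) = if l = i then -1 else 0 := by
    intro i
    rw [← hf.sum_cxa l i]; exact Finset.sum_congr rfl fun j _ => by ring
  simp only [h2] at h6
  simpa using h6

theorem IsFreeSimplex.ofBary_mem {K : GradedSet 𝕜 (Fin g)} (hK : IsFreeSimplex a c K)
    (hf : IsSimplexFrame a c x) {B : Fin (g + 1) → Matrix (Fin n) (Fin n) 𝕜} (hB : ∑ j, B j = 1)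
    (hpos : ∀ j, (B j).PosSemidef) : ofBary x B ∈ K n := by
  refine (hK _ _).mpr ⟨fun i => ?_, fun j => by rw [hf.bary_ofBary hB]; exact hpos j⟩
  rw [Matrix.IsHermitian, ofBary, Matrix.conjTranspose_sum]
  refine Finset.sum_congr rfl fun j _ => ?_
  rw [Matrix.conjTranspose_smul, (hpos j).1]
  simp

/-- Adding and subtracting Δ gives two points of the simplex with midpoint X. This expresses
Euclidean extremality in coordinates. -/
theorem IsFreeSimplex.eq_zero_of_posSemidef_add_sub {K : GradedSet 𝕜 (Fin g)}
    (hK : IsFreeSimplex a c K) (hf : IsSimplexFrame a c x)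
    {X : Fin g → Matrix (Fin n) (Fin n) 𝕜} (hX : X ∈ Set.extremePoints ℝ (K n))
    {Δ : Fin (g + 1) → Matrix (Fin n) (Fin n) 𝕜} (hΔ : ∑ j, Δ j = 0)
    (hadd : ∀ j, (bary a c X j + Δ j).PosSemidef) (hsub : ∀ j, (bary a c X j - Δ j).PosSemidef) :
    Δ = 0 := by
  have hs1 : ∑ j, (bary a c X j + Δ j) = 1 := by
    rw [Finset.sum_add_distrib, hΔ, hf.sum_bary, add_zero]
  have hs2 : ∑ j, (bary a c X j - Δ j) = 1 := by
    rw [Finset.sum_sub_distrib, hΔ, hf.sum_bary, sub_zero]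
  have h1 := hK.ofBary_mem hf hs1 hadd
  have h2 := hK.ofBary_mem hf hs2 hsub
  have hseg : X ∈ openSegment ℝ (ofBary x fun j => bary a c X j + Δ j)
      (ofBary x fun j => bary a c X j - Δ j) := by
    refine ⟨1 / 2, 1 / 2, by norm_num, by norm_num, by norm_num, ?_⟩
    funext i
    conv_rhs => rw [← hf.ofBary_bary X]
    simp only [ofBary, Pi.add_apply, Pi.smul_apply, smul_add, smul_sub, Finset.sum_add_distrib,
      Finset.sum_sub_distrib]
    module
  have h3 := hX.2 h1 h2 hseg
  funext j
  have h4 := hf.bary_ofBary hs1 j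
  rw [h3] at h4
  simpa using h4

/-- Mass `E` lying below two coordinates can be moved from either one to the other. -/
theorem IsFreeSimplex.eq_zero_of_posSemidef_sub {K : GradedSet 𝕜 (Fin g)}
    (hK : IsFreeSimplex a c K) (hf : IsSimplexFrame a c x)
    {X : Fin g → Matrix (Fin n) (Fin n) 𝕜} (hX : X ∈ Set.extremePoints ℝ (K n))
    {j k : Fin (g + 1)} (hjk : j ≠ k) {E : Matrix (Fin n) (Fin n) 𝕜} (hE : E.PosSemidef)
    (hj : (bary a c X j - E).PosSemidef) (hk : (bary a c X k - E).PosSemidef) : E = 0 := by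
  have hps := ((hK _ _).mp hX.1).2
  have h := hK.eq_zero_of_posSemidef_add_sub hf hX (Δ := Pi.single j E - Pi.single k E) (by
    simp [Finset.sum_sub_distrib]) (fun l => ?_) (fun l => ?_)
  · simpa [hjk] using congrFun h j
  · by_cases h1 : l = j
    · subst h1
      simpa [hjk] using (hps l).add hE
    · by_cases h2 : l = k
      · subst h2; simpa [h1, sub_eq_add_neg] using hk
      · simpa [h1, h2] using hps l
  · by_cases h1 : l = j
    · subst h1
      simpa [hjk] using hj
    · by_cases h2 : l = k
      · subst h2; simpa [h1, sub_eq_add_neg] using (hps l).add hE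
      · simpa [h1, h2] using hps l

theorem IsFreeSimplex.posSemidef_one_sub_bary {K : GradedSet 𝕜 (Fin g)}
    (hK : IsFreeSimplex a c K) (hf : IsSimplexFrame a c x)
    {X : Fin g → Matrix (Fin n) (Fin n) 𝕜} (hX : X ∈ K n) (j : Fin (g + 1)) :
    (1 - bary a c X j).PosSemidef := by
  rw [← hf.sum_bary X, ← Finset.sum_erase_eq_sub (Finset.mem_univ j)]
  exact Matrix.posSemidef_sum _ fun k _ => ((hK _ _).mp hX).2 k

theorem Matrix.PosSemidef.sub_mul_self {T : Matrix (Fin n) (Fin n) 𝕜} (h0 : T.PosSemidef)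
    (h1 : (1 - T).PosSemidef) : (T - T * T).PosSemidef := by
  have h2 := h0.conjTranspose_mul_mul_same (1 - T)
  have h3 := h1.conjTranspose_mul_mul_same T
  have h4 := h2.add h3
  rw [h1.1, h0.1] at h4
  convert h4 using 1
  noncomm_ring

theorem IsFreeSimplex.bary_mul_self_of_commute {K : GradedSet 𝕜 (Fin g)}
    (hK : IsFreeSimplex a c K) (hf : IsSimplexFrame a c x)
    {X : Fin g → Matrix (Fin n) (Fin n) 𝕜} (hX : X ∈ Set.extremePoints ℝ (K n))
    (hcomm : ∀ j k, bary a c X j * bary a c X k = bary a c X k * bary a c X j) (j : Fin (g + 1)) :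
    bary a c X j * bary a c X j = bary a c X j := by
  have hps := ((hK _ _).mp hX.1).2
  have h1 := hK.posSemidef_one_sub_bary hf hX.1
  -- T_j - T_j T_k² T_j = (T_j - T_j²) + T_j (1 - T_k²) T_j. If the coordinates commute, the
  -- subtracted matrix lies below T_k as well, so it can be exchanged and must vanish.
  have key : ∀ j k, (bary a c X j - (bary a c X k * bary a c X j)ᴴ *
      (bary a c X k * bary a c X j)).PosSemidef := by
    intro j k
    have h2 := (((hps k).sub_mul_self (h1 k)).add (h1 k)).conjTranspose_mul_mul_same (bary a c X j)
    have h3 := ((hps j).sub_mul_self (h1 j)).add h2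
    convert h3 using 1
    rw [Matrix.conjTranspose_mul, (hps j).1, (hps k).1]
    noncomm_ring
  have hzero : ∀ k, k ≠ j → bary a c X k * bary a c X j = 0 := by
    intro k hk
    have h4 := key k j
    rw [hcomm j k] at h4
    have := hK.eq_zero_of_posSemidef_sub hf hX hk.symm
      (Matrix.posSemidef_conjTranspose_mul_self (bary a c X k * bary a c X j)) (key j k) h4
    exact Matrix.conjTranspose_mul_self_eq_zero.mp this
  have h5 := congrArg (· * bary a c X j) (hf.sum_bary X)
  simp only [Finset.sum_mul, one_mul] at h5
  rw [Finset.sum_eq_single j (fun k _ hk => hzero k hk) (by simp)] at h5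
  exact h5

end bary

/-! ### Real Euclidean extreme points that are not Arveson extreme -/

section real

variable {g n : ℕ} {a : Fin (g + 1) → Fin g → ℝ} {c : Fin (g + 1) → ℝ}
  {x : Fin (g + 1) → Fin g → ℝ} {K : GradedSet ℂ (Fin g)}

theorem IsFreeSimplex.realPart (hK : IsFreeSimplex a c K) : IsFreeSimplex a c K.realPart := by
  intro n X
  have h2 : ∀ i, (complexify X i).IsHermitian ↔ (X i).IsHermitian := by
    intro i
    simp only [Matrix.IsHermitian, ← Matrix.ext_iff, complexify, Matrix.conjTranspose_apply,
      Matrix.map_apply]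
    simp
  change complexify X ∈ K n ↔ _
  rw [hK]
  simp only [bary_complexify, posSemidef_map_ofReal_iff, h2]

theorem complexify_injective {ι : Type} : Function.Injective (complexify (ι := ι) (n := n)) := by
  intro X Y h
  funext i
  exact Matrix.map_injective Complex.ofReal_injective (congrFun h i)

theorem mem_extremePoints_realPart {ι : Type} {K : GradedSet ℂ ι} {X : ι → Matrix (Fin n) (Fin n) ℝ}
    (hX : IsEuclideanExtreme K (complexify X)) : X ∈ Set.extremePoints ℝ (K.realPart n) := by
  refine ⟨hX.1, fun P hP Q hQ hseg => complexify_injective (hX.2 hP hQ ?_)⟩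
  obtain ⟨s, t, hs, ht, hst, rfl⟩ := hseg
  refine ⟨s, t, hs, ht, hst, ?_⟩
  funext i
  ext p q
  simp [complexify]

theorem IsFreeSimplex.isArvesonExtreme_complexify (hK : IsFreeSimplex a c K)
    (hf : IsSimplexFrame a c x) {X : Fin g → Matrix (Fin n) (Fin n) ℝ} (hX : complexify X ∈ K n)
    (hproj : ∀ j, bary a c X j * bary a c X j = bary a c X j) :
    IsArvesonExtreme K (complexify X) := by
  refine hK.isArvesonExtreme hf hX fun j => ?_
  rw [bary_complexify]
  have := Matrix.map_mul (L := bary a c X j) (M := bary a c X j) (f := Complex.ofRealHom)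
  rw [hproj] at this
  exact this.symm

theorem IsFreeSimplex.exists_bary_not_commute (hK : IsFreeSimplex a c K)
    (hf : IsSimplexFrame a c x) {X : Fin g → Matrix (Fin n) (Fin n) ℝ}
    (hX : IsEuclideanExtreme K (complexify X)) (hXA : ¬ IsArvesonExtreme K (complexify X)) :
    ∃ j k, bary a c X j * bary a c X k ≠ bary a c X k * bary a c X j := by
  by_contra! h
  exact hXA (hK.isArvesonExtreme_complexify hf hX.1
    (hK.realPart.bary_mul_self_of_commute hf (mem_extremePoints_realPart hX) h))

theorem Matrix.trace_smul_sub_det_smul_one (T : Matrix (Fin 2) (Fin 2) ℝ) :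
    T.trace • T - T.det • 1 = T * T := by
  ext p q
  fin_cases p <;> fin_cases q <;>
    simp [Matrix.trace_fin_two, Matrix.det_fin_two, Matrix.mul_apply] <;> ring

/-- An invertible coordinate dominates ε·1, hence ε T_k for every other k; exchanging this mass
forces T_k = 0. The coordinates would then be 1 and zeros, all projections, and X would be Arveson
extreme. -/
theorem IsFreeSimplex.det_bary_eq_zero (hK : IsFreeSimplex a c K)
    (hf : IsSimplexFrame a c x) {X : Fin g → Matrix (Fin 2) (Fin 2) ℝ}
    (hX : IsEuclideanExtreme K (complexify X)) (hXA : ¬ IsArvesonExtreme K (complexify X))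
    (j : Fin (g + 1)) : (bary a c X j).det = 0 := by
  by_contra hdet
  have hXr := mem_extremePoints_realPart hX
  have hps := ((hK.realPart _ _).mp hXr.1).2
  have h1 := hK.realPart.posSemidef_one_sub_bary hf hXr.1
  have htr := (hps j).trace_nonneg
  have hd : 0 < (bary a c X j).det := lt_of_le_of_ne (hps j).det_nonneg (Ne.symm hdet)
  set T := bary a c X j with hT
  have hsum : 0 < T.trace + T.det := by linarith
  set ε := T.det / (T.trace + T.det) with hε
  have hε0 : 0 < ε := div_pos hd hsum
  have hε1 : ε ≤ 1 := (div_le_one hsum).mpr (by linarith)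
  have hTε : (T - ε • (1 : Matrix (Fin 2) (Fin 2) ℝ)).PosSemidef := by
    -- By Cayley–Hamilton T² + (det T) T = (tr T + det T) T - det T, which gives an explicit ε
    -- without eigenvalues.
    have h2 : (T.trace + T.det)⁻¹ • (Tᴴ * T + T.det • T) = T - ε • 1 := by
      rw [(hps j).1, ← Matrix.trace_smul_sub_det_smul_one, hε, div_eq_inv_mul, mul_smul, ← sub_eq_zero]
      have : T.trace • T - T.det • 1 + T.det • T = (T.trace + T.det) • T - T.det • 1 := by module
      rw [this, smul_sub, smul_smul, inv_mul_cancel₀ hsum.ne', one_smul, sub_self]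
    rw [← h2]
    exact ((Matrix.posSemidef_conjTranspose_mul_self T).add ((hps j).smul hd.le)).smul
      (inv_nonneg.mpr hsum.le)
  have hzero : ∀ k, k ≠ j → bary a c X k = 0 := by
    intro k hk
    have h3 := hK.realPart.eq_zero_of_posSemidef_sub hf hXr hk.symm ((hps k).smul hε0.le) (by
      have h4 : T - ε • 1 + ε • (1 - bary a c X k) = T - ε • bary a c X k := by module
      rw [← hT, ← h4]
      exact hTε.add ((h1 k).smul hε0.le)) (by
      have h4 : (1 - ε) • bary a c X k = bary a c X k - ε • bary a c X k := by module
      rw [← h4]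
      exact (hps k).smul (sub_nonneg.mpr hε1))
    exact (smul_eq_zero.mp h3).resolve_left hε0.ne'
  have hone : T = 1 := by
    rw [← hf.sum_bary X]
    exact (Finset.sum_eq_single j (fun k _ hk => hzero k hk) (by simp)).symm
  refine hXA (hK.isArvesonExtreme_complexify hf hX.1 fun k => ?_)
  by_cases hk : k = j
  · rw [hk, ← hT, hone, mul_one]
  · rw [hzero k hk, mul_zero]

end real

/-! ### Block matrix algebra -/

section blockMat

variable {𝕜 : Type} {m n : ℕ}

theorem blockMat_inj {A A' : Matrix (Fin m) (Fin m) 𝕜} {B B' : Matrix (Fin m) (Fin n) 𝕜}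
    {C C' : Matrix (Fin n) (Fin m) 𝕜} {D D' : Matrix (Fin n) (Fin n) 𝕜} :
    blockMat A B C D = blockMat A' B' C' D' ↔ A = A' ∧ B = B' ∧ C = C' ∧ D = D' := by
  rw [blockMat, blockMat, EmbeddingLike.apply_eq_iff_eq, Matrix.fromBlocks_inj]

theorem blockMat_mul [CommRing 𝕜] (A A' : Matrix (Fin m) (Fin m) 𝕜) (B B' : Matrix (Fin m) (Fin n) 𝕜)
    (C C' : Matrix (Fin n) (Fin m) 𝕜) (D D' : Matrix (Fin n) (Fin n) 𝕜) :
    blockMat A B C D * blockMat A' B' C' D' =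
      blockMat (A * A' + B * C') (A * B' + B * D') (C * A' + D * C') (C * B' + D * D') := by
  simp only [blockMat, Matrix.reindex_apply, Matrix.submatrix_mul_equiv, Matrix.fromBlocks_multiply]

theorem blockMat_one [CommRing 𝕜] : blockMat (1 : Matrix (Fin m) (Fin m) 𝕜) 0 0
    (1 : Matrix (Fin n) (Fin n) 𝕜) = 1 := by
  simp [blockMat]

theorem blockMat_sub [CommRing 𝕜] (A A' : Matrix (Fin m) (Fin m) 𝕜) (B B' : Matrix (Fin m) (Fin n) 𝕜)
    (C C' : Matrix (Fin n) (Fin m) 𝕜) (D D' : Matrix (Fin n) (Fin n) 𝕜) :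
    blockMat A B C D - blockMat A' B' C' D' = blockMat (A - A') (B - B') (C - C') (D - D') := by
  simp only [blockMat, Matrix.reindex_apply, sub_eq_add_neg, ← Matrix.fromBlocks_add,
    ← Matrix.fromBlocks_neg]
  rfl

theorem blockMat_conjTranspose [RCLike 𝕜] (A : Matrix (Fin m) (Fin m) 𝕜)
    (B : Matrix (Fin m) (Fin n) 𝕜) (C : Matrix (Fin n) (Fin m) 𝕜) (D : Matrix (Fin n) (Fin n) 𝕜) :
    (blockMat A B C D)ᴴ = blockMat Aᴴ Cᴴ Bᴴ Dᴴ := by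
  simp only [blockMat, Matrix.reindex_apply, Matrix.conjTranspose_submatrix,
    Matrix.fromBlocks_conjTranspose]

theorem Matrix.PosSemidef.blockMat [RCLike 𝕜] {A : Matrix (Fin m) (Fin m) 𝕜}
    {D : Matrix (Fin n) (Fin n) 𝕜} (hA : A.PosSemidef) (hD : D.PosSemidef) :
    (blockMat A 0 0 D).PosSemidef := by
  open scoped MatrixOrder in
  obtain ⟨E, rfl⟩ := CStarAlgebra.nonneg_iff_eq_star_mul_self.mp hA.nonneg
  open scoped MatrixOrder in
  obtain ⟨F, rfl⟩ := CStarAlgebra.nonneg_iff_eq_star_mul_self.mp hD.nonneg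
  have := Matrix.posSemidef_conjTranspose_mul_self (_root_.blockMat E 0 0 F)
  rw [blockMat_conjTranspose, blockMat_mul] at this
  simpa [Matrix.star_eq_conjTranspose] using this

end blockMat

/-! ### The matrix interval and its Arveson extreme points -/

section matrixInterval

variable {𝕜 : Type} [RCLike 𝕜] {n : ℕ}

theorem posSemidef_one_sub_of_mul_self {W : Matrix (Fin n) (Fin n) 𝕜} (hW : W.IsHermitian)
    (h : (1 - W * W).PosSemidef) : (1 - W).PosSemidef := by
  have h1 := ((Matrix.posSemidef_conjTranspose_mul_self (1 - W)).add h).smul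
    (by norm_num : (0 : ℝ) ≤ 1 / 2)
  have h2 : (1 / 2 : ℝ) • ((1 - W)ᴴ * (1 - W) + (1 - W * W)) = 1 - W := by
    rw [Matrix.conjTranspose_sub, Matrix.conjTranspose_one, hW]
    have : (1 - W) * (1 - W) + (1 - W * W) = (2 : ℝ) • (1 - W) := by
      rw [two_smul]; noncomm_ring
    rw [this, smul_smul]; norm_num
  rwa [h2] at h1

theorem mem_matrixInterval_of_mul_self {Y : Fin 1 → Matrix (Fin n) (Fin n) 𝕜}
    (hY : (Y 0).IsHermitian) (h : (1 - Y 0 * Y 0).PosSemidef) : Y ∈ matrixInterval 𝕜 n := by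
  refine (mem_matrixInterval_iff Y).mpr ⟨hY, posSemidef_one_sub_of_mul_self hY h, ?_⟩
  have := posSemidef_one_sub_of_mul_self (W := -Y 0) hY.neg (by simpa using h)
  simpa using this

theorem IsArvesonExtreme.mul_self_eq_one {Y : Matrix (Fin n) (Fin n) 𝕜}
    (hY : IsArvesonExtreme (matrixInterval 𝕜) (fun _ : Fin 1 => Y)) : Y.IsHermitian ∧ Y * Y = 1 := by
  obtain ⟨hH, hm, hp⟩ := (mem_matrixInterval_iff _).mp hY.1
  refine ⟨hH, ?_⟩
  have hD : (1 - Y * Y).PosSemidef := by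
    have h1 := ((hp.conjTranspose_mul_mul_same (1 - Y)).add
      (hm.conjTranspose_mul_mul_same (1 + Y))).smul (by norm_num : (0 : ℝ) ≤ 1 / 2)
    have h2 : (1 / 2 : ℝ) • ((1 - Y)ᴴ * (1 + Y) * (1 - Y) + (1 + Y)ᴴ * (1 - Y) * (1 + Y)) =
        1 - Y * Y := by
      rw [hm.1, hp.1]
      have : (1 - Y) * (1 + Y) * (1 - Y) + (1 + Y) * (1 - Y) * (1 + Y) =
          (2 : ℝ) • (1 - Y * Y) := by
        rw [two_smul]; noncomm_ring
      rw [this, smul_smul]; norm_num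
    rwa [h2] at h1
  -- With D = 1 - Y², the dilation with rows (Y, D) and (D, -Y) has square (Y² + D²) ⊕ (Y² + D²),
  -- and 1 - Y² - D² = Y D Y ≥ 0. So it lies in the interval, and Arveson extremality gives D = 0.
  have h := hY.2 n (fun _ => 1 - Y * Y) (fun _ => -Y) (by
    refine mem_matrixInterval_of_mul_self ?_ ?_
    · change (blockMat _ _ _ _)ᴴ = _
      rw [blockMat_conjTranspose, Matrix.conjTranspose_conjTranspose, Matrix.conjTranspose_neg, hH]
    · rw [blockMat_mul, ← blockMat_one, blockMat_sub, hD.1]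
      have e1 : (0 : Matrix (Fin n) (Fin n) 𝕜) - (Y * (1 - Y * Y) + (1 - Y * Y) * -Y) = 0 := by
        noncomm_ring
      have e2 : (0 : Matrix (Fin n) (Fin n) 𝕜) - ((1 - Y * Y) * Y + -Y * (1 - Y * Y)) = 0 := by
        noncomm_ring
      rw [e1, e2]
      have h3 := hD.conjTranspose_mul_mul_same Y
      rw [hH] at h3
      refine Matrix.PosSemidef.blockMat ?_ ?_
      · convert h3 using 1; noncomm_ring
      · convert h3 using 1; noncomm_ring) 0
  exact (sub_eq_zero.mp h).symm

end matrixInterval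

/-! ### Rigidity of convex combinations, and two-by-two reality arguments -/

theorem Matrix.PosSemidef.eq_zero_of_sum_eq_zero {𝕜 : Type} [RCLike 𝕜] {ι : Type} [Fintype ι]
    {n : ℕ} {M : ι → Matrix (Fin n) (Fin n) 𝕜} (hM : ∀ i, (M i).PosSemidef) (h : ∑ i, M i = 0)
    (i : ι) : M i = 0 := by
  have h1 := congrArg Matrix.trace h
  rw [Matrix.trace_sum, Matrix.trace_zero] at h1
  exact (hM i).trace_eq_zero_iff.mp
    ((Finset.sum_eq_zero_iff_of_nonneg fun i _ => (hM i).trace_nonneg).mp h1 i (Finset.mem_univ i))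

theorem Matrix.PosSemidef.mul_eq_zero_of_sum {𝕜 : Type} [RCLike 𝕜] {n m s : ℕ} {k : Fin s → ℕ}
    {A : Matrix (Fin n) (Fin n) 𝕜} {B : (i : Fin s) → Matrix (Fin (k i)) (Fin (k i)) 𝕜}
    {V : (i : Fin s) → Matrix (Fin (k i)) (Fin n) 𝕜} (hB : ∀ i, (B i).PosSemidef)
    (h : A = ∑ i, (V i)ᴴ * B i * V i) {C : Matrix (Fin n) (Fin m) 𝕜} (hC : A * C = 0) (i : Fin s) :
    B i * (V i * C) = 0 := by
  have h1 : ∑ i, (V i * C)ᴴ * B i * (V i * C) = 0 := by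
    have h2 : Cᴴ * A * C = 0 := by rw [Matrix.mul_assoc, hC, Matrix.mul_zero]
    rw [h, Matrix.mul_sum, Matrix.sum_mul] at h2
    rw [← h2]
    refine Finset.sum_congr rfl fun i _ => ?_
    rw [Matrix.conjTranspose_mul]
    simp only [Matrix.mul_assoc]
  exact (hB i).mul_eq_zero_of_conjTranspose_mul_mul_eq_zero
    (Matrix.PosSemidef.eq_zero_of_sum_eq_zero
      (fun i => (hB i).conjTranspose_mul_mul_same (V i * C)) h1 i)

/-- As (1 - Y)(1 + Y) = 0, kernel propagation through the combination gives (1 - P)V(1 + Y) = 0 and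
(1 + P)V(1 - Y) = 0; their difference is the intertwining relation. -/
theorem IsMatrixConvexCombination.mul_eq_mul_of_mul_self_eq_one {𝕜 : Type} [RCLike 𝕜] {n s : ℕ}
    {Y : Matrix (Fin n) (Fin n) 𝕜} (hY : Y * Y = 1) {k : Fin s → ℕ}
    {P : (i : Fin s) → Fin 1 → Matrix (Fin (k i)) (Fin (k i)) 𝕜}
    {V : (i : Fin s) → Matrix (Fin (k i)) (Fin n) 𝕜}
    (h : IsMatrixConvexCombination (fun _ : Fin 1 => Y) k P V)
    (hP : ∀ i, P i ∈ matrixInterval 𝕜 (k i)) (i : Fin s) : P i 0 * V i = V i * Y := by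
  have hP' := fun i => (mem_matrixInterval_iff _).mp (hP i)
  have hs := h.sum_eq_one
  have he := h.eq_sum 0
  have h1 := Matrix.PosSemidef.mul_eq_zero_of_sum (A := 1 - Y) (fun i => (hP' i).2.1) (V := V) (by
    simp only [Matrix.mul_sub, Matrix.sub_mul, Finset.sum_sub_distrib, Matrix.mul_one]
    rw [hs, ← he]) (C := 1 + Y) (by
      rw [show (1 - Y) * (1 + Y) = 1 - Y * Y by noncomm_ring, hY, sub_self]) i
  have h2 := Matrix.PosSemidef.mul_eq_zero_of_sum (A := 1 + Y) (fun i => (hP' i).2.2) (V := V) (by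
    simp only [Matrix.mul_add, Matrix.add_mul, Finset.sum_add_distrib, Matrix.mul_one]
    rw [hs, ← he]) (C := 1 - Y) (by
      rw [show (1 + Y) * (1 - Y) = 1 - Y * Y by noncomm_ring, hY, sub_self]) i
  simp only [Matrix.mul_add, Matrix.mul_sub, Matrix.add_mul, Matrix.sub_mul, Matrix.mul_one,
    Matrix.one_mul] at h1 h2
  have h3 : (2 : 𝕜) • (P i 0 * V i - V i * Y) = 0 := by
    have e : (2 : 𝕜) • (P i 0 * V i - V i * Y) =
        (V i + P i 0 * V i - (V i * Y + P i 0 * (V i * Y))) -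
          (V i - P i 0 * V i + (V i * Y - P i 0 * (V i * Y))) := by module
    rw [e, h1, h2, sub_zero]
  exact sub_eq_zero.mp ((smul_eq_zero.mp h3).resolve_left two_ne_zero)

/-- `Q` is dominated by a real singular matrix, so it kills a nonzero real vector; the imaginary
part of that equation involves only the off-diagonal entries. -/
theorem im_apply_zero_one_eq_zero {T : Matrix (Fin 2) (Fin 2) ℝ} (hT : T.det = 0)
    {Q : Matrix (Fin 2) (Fin 2) ℂ} (hQ : Q.PosSemidef)
    (hTQ : (T.map Complex.ofReal - Q).PosSemidef) : (Q 0 1).im = 0 := by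
  obtain ⟨u, hu0, hu⟩ := Matrix.exists_mulVec_eq_zero_iff.mpr hT
  set C : Matrix (Fin 2) (Fin 1) ℂ := Matrix.of fun i _ => (u i : ℂ) with hC
  have hTC : T.map Complex.ofReal * C = 0 := by
    ext i j
    have := congrFun hu i
    simp only [Matrix.mulVec, dotProduct, Fin.sum_univ_two, Pi.zero_apply] at this
    simp only [hC, Matrix.mul_apply, Fin.sum_univ_two, Matrix.map_apply, Matrix.of_apply,
      Matrix.zero_apply]
    exact_mod_cast this
  have h1 : Cᴴ * Q * C = 0 := by
    have hs : ∑ i : Fin 2, (![Cᴴ * Q * C, Cᴴ * (T.map Complex.ofReal - Q) * C] i) = 0 := by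
      simp only [Fin.sum_univ_two, Matrix.cons_val_zero, Matrix.cons_val_one, Matrix.mul_sub,
        Matrix.sub_mul]
      rw [add_sub_cancel, Matrix.mul_assoc, hTC, Matrix.mul_zero]
    exact Matrix.PosSemidef.eq_zero_of_sum_eq_zero (by
      rw [Fin.forall_fin_two]
      exact ⟨hQ.conjTranspose_mul_mul_same C, hTQ.conjTranspose_mul_mul_same C⟩) hs 0
  have h2 := hQ.mul_eq_zero_of_conjTranspose_mul_mul_eq_zero h1
  have e0 := congrArg Complex.im (congrFun (congrFun h2 0) 0)
  have e1 := congrArg Complex.im (congrFun (congrFun h2 1) 0)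
  have d0 := congrArg Complex.im (hQ.1.apply 0 0)
  have d1 := congrArg Complex.im (hQ.1.apply 1 1)
  have d2 := congrArg Complex.im (hQ.1.apply 0 1)
  simp [hC, Matrix.mul_apply, Fin.sum_univ_two] at e0 e1 d0 d1 d2
  have d0' : (Q 0 0).im = 0 := by linarith
  have d1' : (Q 1 1).im = 0 := by linarith
  rw [d0'] at e0
  rw [d1'] at e1
  by_contra hne
  apply hu0
  funext i
  have hne' : (Q 1 0).im ≠ 0 := fun h => hne (by linarith)
  fin_cases i
  · simpa [hne'] using e1
  · simpa [hne] using e0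

theorem eq_smul_one_of_commute {G Y : Matrix (Fin 2) (Fin 2) ℂ} (hG : G.IsHermitian)
    (hGim : (G 0 1).im = 0) (hY : Y.IsHermitian) (hYim : (Y 0 1).im ≠ 0) (h : G * Y = Y * G) :
    G = (G 0 0).re • 1 := by
  have d0 := hG.apply 0 0
  have d1 := hG.apply 1 1
  have d2 := hG.apply 0 1
  have y2 := hY.apply 0 1
  have e00 := congrFun (congrFun h 0) 0
  have e01 := congrFun (congrFun h 0) 1
  simp only [Matrix.mul_apply, Fin.sum_univ_two] at e00 e01
  simp only [Complex.ext_iff, RCLike.star_def, Complex.conj_re, Complex.conj_im, Complex.add_re,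
    Complex.add_im, Complex.mul_re, Complex.mul_im] at d0 d1 d2 y2 e00 e01
  have g0 : (G 0 0).im = 0 := by linarith [d0.2]
  have g1 : (G 1 1).im = 0 := by linarith [d1.2]
  have hre : (G 0 1).re = 0 := by
    have h1 := e00.2
    rw [hGim, ← y2.2, d2.1] at h1
    have h2 : (G 1 0).im = 0 := by linarith [d2.2]
    rw [h2, y2.1] at h1
    have h3 : (G 0 1).re * (Y 0 1).im = 0 := by
      have := y2.2
      rw [← this]
      linarith
    exact (mul_eq_zero.mp h3).resolve_right hYim
  have hdd : (G 0 0).re = (G 1 1).re := by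
    have h1 := e01.2
    rw [hGim, hre, g0, g1] at h1
    have h3 : ((G 0 0).re - (G 1 1).re) * (Y 0 1).im = 0 := by linarith
    linarith [(mul_eq_zero.mp h3).resolve_right hYim]
  ext i j
  fin_cases i <;> fin_cases j <;> apply Complex.ext <;>
    simp [g0, g1, hre, hGim, hdd, d2.1]
  linarith [d2.2]

/-- A surjective matrix with scalar Gram matrix is a multiple of a unitary. -/
theorem exists_unitary_of_conjTranspose_mul_self_eq_smul_one {k n : ℕ}
    {V : Matrix (Fin k) (Fin n) ℂ} (hV : Function.Surjective V.mulVec) {μ : ℝ} (hμ : 0 < μ)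
    (h : Vᴴ * V = μ • 1) :
    k = n ∧ ∃ U : Matrix (Fin n) (Fin k) ℂ, U * Uᴴ = 1 ∧ Uᴴ * U = 1 ∧
      ∀ M : Matrix (Fin k) (Fin k) ℂ, U * M * Uᴴ = μ⁻¹ • (Vᴴ * M * V) := by
  have hsq : (Real.sqrt μ)⁻¹ * (Real.sqrt μ)⁻¹ = μ⁻¹ := by
    rw [← mul_inv, Real.mul_self_sqrt hμ.le]
  set U : Matrix (Fin n) (Fin k) ℂ := (Real.sqrt μ)⁻¹ • Vᴴ with hU
  have hUc : Uᴴ = (Real.sqrt μ)⁻¹ • V := by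
    rw [hU, Matrix.conjTranspose_smul, Matrix.conjTranspose_conjTranspose]
    simp
  have hconj : ∀ M : Matrix (Fin k) (Fin k) ℂ, U * M * Uᴴ = μ⁻¹ • (Vᴴ * M * V) := by
    intro M
    rw [hUc, hU, Matrix.smul_mul, Matrix.smul_mul, Matrix.mul_smul, smul_smul, hsq]
  have h1 : U * Uᴴ = 1 := by
    have := hconj 1
    rw [Matrix.mul_one, Matrix.mul_one, h, smul_smul, inv_mul_cancel₀ hμ.ne', one_smul] at this
    exact this
  have h2 : Uᴴ * U = 1 := by
    refine Matrix.ext_iff_mulVec.mpr fun v => ?_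
    obtain ⟨w, rfl⟩ := hV v
    have h3 : Uᴴ * U = μ⁻¹ • (V * Vᴴ) := by
      rw [hUc, hU, Matrix.smul_mul, Matrix.mul_smul, smul_smul, hsq]
    rw [Matrix.one_mulVec, Matrix.mulVec_mulVec, h3, Matrix.smul_mul, Matrix.mul_assoc, h,
      Matrix.mul_smul, smul_smul, inv_mul_cancel₀ hμ.ne', one_smul, Matrix.mul_one]
  refine ⟨?_, U, h1, h2, hconj⟩
  have h3 := congrArg Matrix.trace h1
  rw [Matrix.trace_mul_comm, h2, Matrix.trace_one, Matrix.trace_one] at h3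
  simpa using h3

/-! ### Domination and conjugation in a free simplex -/

section extreme

variable {𝕜 : Type} [RCLike 𝕜] {g n : ℕ} {a : Fin (g + 1) → Fin g → ℝ} {c : Fin (g + 1) → ℝ}
  {x : Fin (g + 1) → Fin g → ℝ}

/-- Domination of μ times the coordinates of Z lets the segment from Z to X be prolonged beyond X
inside the simplex. The factor μ / (1 + μ) makes a step of that length admissible in both
directions. -/
theorem IsFreeSimplex.eq_of_posSemidef_sub_smul {K : GradedSet 𝕜 (Fin g)}
    (hK : IsFreeSimplex a c K) (hf : IsSimplexFrame a c x)
    {X Z : Fin g → Matrix (Fin n) (Fin n) 𝕜} (hX : X ∈ Set.extremePoints ℝ (K n)) (hZ : Z ∈ K n)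
    {μ : ℝ} (hμ : 0 < μ) (h : ∀ j, (bary a c X j - μ • bary a c Z j).PosSemidef) : Z = X := by
  have hX' := ((hK _ _).mp hX.1).2
  have hZ' := ((hK _ _).mp hZ).2
  have hp : 0 < 1 + μ := by linarith
  have h1 := hK.eq_zero_of_posSemidef_add_sub hf hX
    (Δ := fun j => (μ / (1 + μ)) • (bary a c Z j - bary a c X j)) (by
      rw [← Finset.smul_sum, Finset.sum_sub_distrib, hf.sum_bary, hf.sum_bary, sub_self,
        smul_zero]) (fun j => by
      have e : bary a c X j + (μ / (1 + μ)) • (bary a c Z j - bary a c X j) =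
          (1 / (1 + μ)) • bary a c X j + (μ / (1 + μ)) • bary a c Z j := by
        match_scalars <;> field_simp <;> ring
      rw [e]
      exact ((hX' j).smul (by positivity)).add ((hZ' j).smul (by positivity))) (fun j => by
      have e : bary a c X j - (μ / (1 + μ)) • (bary a c Z j - bary a c X j) =
          (2 * μ / (1 + μ)) • bary a c X j +
            (1 / (1 + μ)) • (bary a c X j - μ • bary a c Z j) := by
        match_scalars <;> field_simp <;> ring
      rw [e]
      exact ((hX' j).smul (by positivity)).add ((h j).smul (by positivity)))
  have h2 : ∀ j, bary a c Z j = bary a c X j := by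
    intro j
    have := congrFun h1 j
    exact sub_eq_zero.mp ((smul_eq_zero.mp this).resolve_left (by positivity))
  rw [← hf.ofBary_bary Z, ← hf.ofBary_bary X]
  congr 1
  funext j
  exact h2 j

theorem bary_conj {m : ℕ} (X : Fin g → Matrix (Fin n) (Fin n) 𝕜) {U : Matrix (Fin m) (Fin n) 𝕜}
    (hU : U * Uᴴ = 1) (j : Fin (g + 1)) :
    bary a c (fun i => U * X i * Uᴴ) j = U * bary a c X j * Uᴴ := by
  have := bary_smul_sub_sum (a := a) (c := c) X Uᴴ j
  rw [Matrix.conjTranspose_conjTranspose, hU] at this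
  exact this.symm

theorem IsFreeSimplex.conj_mem {K : GradedSet 𝕜 (Fin g)} (hK : IsFreeSimplex a c K) {m : ℕ}
    {X : Fin g → Matrix (Fin n) (Fin n) 𝕜} (hX : X ∈ K n) {U : Matrix (Fin m) (Fin n) 𝕜}
    (hU : U * Uᴴ = 1) : (fun i => U * X i * Uᴴ) ∈ K m := by
  rw [hK] at hX ⊢
  refine ⟨fun i => Matrix.isHermitian_mul_mul_conjTranspose U (hX.1 i), fun j => ?_⟩
  rw [bary_conj X hU]
  exact (hX.2 j).mul_mul_conjTranspose_same U

theorem commute_bary {X : Fin g → Matrix (Fin n) (Fin n) 𝕜}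
    (h : ∀ i l, X i * X l = X l * X i) (j k : Fin (g + 1)) :
    bary a c X j * bary a c X k = bary a c X k * bary a c X j := by
  have h1 : Commute (∑ i, a j i • X i) (∑ i, a k i • X i) :=
    Commute.sum_left _ _ _ fun i _ => Commute.sum_right _ _ _ fun l _ =>
      ((show Commute (X i) (X l) from h i l).smul_left _).smul_right _
  have h2 : Commute (bary a c X j) (bary a c X k) :=
    (((Commute.one_left _).sub_left ((Commute.one_right _).sub_right h1)).smul_left _).smul_right _
  exact h2

end extreme

/-! ### The complex product: matrix extreme but not free extreme -/

section complex

variable {g : ℕ} {a : Fin (g + 1) → Fin g → ℝ} {c : Fin (g + 1) → ℝ}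
  {x : Fin (g + 1) → Fin g → ℝ} {K : GradedSet ℂ (Fin g)}

theorem IsMatrixConvexCombination.sum_conj_bary {n s : ℕ} {X : Fin g → Matrix (Fin n) (Fin n) ℂ}
    {k : Fin s → ℕ} {P : (i : Fin s) → Fin g → Matrix (Fin (k i)) (Fin (k i)) ℂ}
    {V : (i : Fin s) → Matrix (Fin (k i)) (Fin n) ℂ} (h : IsMatrixConvexCombination X k P V)
    (j : Fin (g + 1)) : ∑ i, (V i)ᴴ * bary a c (P i) j * V i = bary a c X j := by
  simp only [bary_smul_sub_sum]
  rw [← Finset.smul_sum, Finset.sum_sub_distrib, h.sum_eq_one, Finset.sum_comm]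
  simp only [← Finset.smul_sum, ← h.eq_sum]
  rfl

theorem IsFreeSimplex.isMatrixExtreme_prod (hK : IsFreeSimplex a c K) (hf : IsSimplexFrame a c x)
    {X : Fin g → Matrix (Fin 2) (Fin 2) ℝ} (hX : IsEuclideanExtreme K (complexify X))
    (hXA : ¬ IsArvesonExtreme K (complexify X)) {Y : Matrix (Fin 2) (Fin 2) ℂ}
    (hY : IsArvesonExtreme (matrixInterval ℂ) (fun _ : Fin 1 => Y)) (hYim : (Y 0 1).im ≠ 0) :
    IsMatrixExtreme (K.prod (matrixInterval ℂ)) (Sum.elim (complexify X) (fun _ : Fin 1 => Y)) := by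
  obtain ⟨hYH, hYY⟩ := hY.mul_self_eq_one
  refine ⟨⟨hX.1, hY.1⟩, fun s k P V hP hV hsurj i => ?_⟩
  have hVX : IsMatrixConvexCombination (complexify X) k (fun i l => P i (Sum.inl l)) V :=
    ⟨hV.size_pos, hV.sum_eq_one, fun l => hV.eq_sum (Sum.inl l)⟩
  have hVY : IsMatrixConvexCombination (fun _ : Fin 1 => Y) k (fun i l => P i (Sum.inr l)) V :=
    ⟨hV.size_pos, hV.sum_eq_one, fun l => hV.eq_sum (Sum.inr l)⟩
  have hcomm := hVY.mul_eq_mul_of_mul_self_eq_one hYY (fun i => (hP i).2) i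
  have hPX := fun i => ((hK _ _).mp (hP i).1).2
  -- The contribution of the i-th term to each coordinate of X: it lies between 0 and that
  -- coordinate, and the sum over j is V_i* V_i.
  set Q : Fin (g + 1) → Matrix (Fin 2) (Fin 2) ℂ := fun j =>
    (V i)ᴴ * bary a c (fun l => P i (Sum.inl l)) j * V i with hQ
  have hQpos : ∀ j, (Q j).PosSemidef := fun j => (hPX i j).conjTranspose_mul_mul_same (V i)
  have hQle : ∀ j, (bary a c (complexify X) j - Q j).PosSemidef := by
    intro j
    rw [← hVX.sum_conj_bary j, hQ,
      ← Finset.sum_erase_eq_sub (f := fun i => (V i)ᴴ * bary a c (fun l => P i (Sum.inl l)) j * V i)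
        (Finset.mem_univ i)]
    exact Matrix.posSemidef_sum _ fun i _ => (hPX i j).conjTranspose_mul_mul_same (V i)
  have hG : (V i)ᴴ * V i = ∑ j, Q j := by
    rw [hQ, ← Matrix.sum_mul, ← Matrix.mul_sum, hf.sum_bary, Matrix.mul_one]
  have hGim : (((V i)ᴴ * V i) 0 1).im = 0 := by
    rw [hG, Matrix.sum_apply, Complex.im_sum]
    refine Finset.sum_eq_zero fun j _ => im_apply_zero_one_eq_zero
      (hK.det_bary_eq_zero hf hX hXA j) (hQpos j) ?_
    rw [← bary_complexify]
    exact hQle j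
  have hGH : ((V i)ᴴ * V i).IsHermitian := Matrix.isHermitian_conjTranspose_mul_self _
  have hPY : (P i (Sum.inr 0)).IsHermitian := (hP i).2.1 0
  have hGY : (V i)ᴴ * V i * Y = (V i)ᴴ * P i (Sum.inr 0) * V i := by
    rw [Matrix.mul_assoc, ← hcomm, Matrix.mul_assoc]
  have hGcomm : (V i)ᴴ * V i * Y = Y * ((V i)ᴴ * V i) := by
    have h1 := congrArg Matrix.conjTranspose hGY
    rw [Matrix.conjTranspose_mul, hGH, hYH, Matrix.conjTranspose_mul, Matrix.conjTranspose_mul,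
      hPY, Matrix.conjTranspose_conjTranspose, ← Matrix.mul_assoc (V i)ᴴ, ← hGY] at h1
    exact h1.symm
  have hscalar := eq_smul_one_of_commute hGH hGim hYH hYim hGcomm
  set μ := (((V i)ᴴ * V i) 0 0).re with hμ
  have hμ0 : 0 < μ := by
    have h0 : 0 ≤ μ :=
      (Complex.nonneg_iff.mp (Matrix.posSemidef_conjTranspose_mul_self (V i)).diag_nonneg).1
    refine lt_of_le_of_ne h0 fun h => ?_
    rw [← h, zero_smul, Matrix.conjTranspose_mul_self_eq_zero] at hscalar
    obtain ⟨w, hw⟩ := hsurj i (fun _ => 1)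
    have := congrFun hw ⟨0, hV.size_pos i⟩
    simp [hscalar] at this
  obtain ⟨hk, U, hU1, hU2, hU⟩ :=
    exists_unitary_of_conjTranspose_mul_self_eq_smul_one (hsurj i) hμ0 hscalar
  refine ⟨hk, U, hU1, hU2, ?_⟩
  have hZ := hK.conj_mem (hP i).1 hU1
  have hZX := hK.eq_of_posSemidef_sub_smul hf hX hZ hμ0 (fun j => by
    rw [bary_conj _ hU1, hU, smul_smul, mul_inv_cancel₀ hμ0.ne', one_smul]
    exact hQle j)
  rintro (l | l)
  · exact congrFun hZX l
  · obtain rfl := Subsingleton.elim l 0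
    rw [hU, ← hGY, hscalar, Matrix.smul_mul, Matrix.one_mul, smul_smul, inv_mul_cancel₀ hμ0.ne', one_smul]
    rfl

theorem commute_of_unitarilyEquivalent {ι : Type} {m n : ℕ} {Z : ι → Matrix (Fin m) (Fin m) ℂ}
    {W : ι → Matrix (Fin n) (Fin n) ℂ} (h : UnitarilyEquivalent Z W) {i l : ι}
    (hZ : Z i * Z l = Z l * Z i) : W i * W l = W l * W i := by
  obtain ⟨U, -, hU, hW⟩ := h
  have key : ∀ i l, W i * W l = U * (Z i * Z l) * Uᴴ := by
    intro i l
    rw [← hW, ← hW]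
    calc U * Z i * Uᴴ * (U * Z l * Uᴴ) = U * Z i * (Uᴴ * U) * Z l * Uᴴ := by
          simp only [Matrix.mul_assoc]
      _ = U * (Z i * Z l) * Uᴴ := by rw [hU]; simp only [Matrix.mul_assoc, Matrix.one_mul]
  rw [key, key, hZ]

/-- Every point of a free simplex is a compression of a tuple of commuting matrices in it. -/
theorem IsFreeSimplex.exists_commuting_dilation (hK : IsFreeSimplex a c K)
    (hf : IsSimplexFrame a c x) {n : ℕ} {X : Fin g → Matrix (Fin n) (Fin n) ℂ} (hX : X ∈ K n) :
    ∃ (Z : Fin g → Matrix (Fin ((g + 1) * n)) (Fin ((g + 1) * n)) ℂ)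
      (V : Matrix (Fin ((g + 1) * n)) (Fin n) ℂ), Z ∈ K ((g + 1) * n) ∧ Vᴴ * V = 1 ∧
      (∀ i, X i = Vᴴ * Z i * V) ∧ ∀ i l, Z i * Z l = Z l * Z i := by
  have hB : ∀ j, ∃ B : Matrix (Fin n) (Fin n) ℂ, bary a c X j = Bᴴ * B := by
    intro j
    open scoped MatrixOrder in
    exact CStarAlgebra.nonneg_iff_eq_star_mul_self.mp (((hK _ _).mp hX).2 j).nonneg
  choose B hB using hB
  set e := (finProdFinEquiv (m := g + 1) (n := n)).symm with he
  set V : Matrix (Fin ((g + 1) * n)) (Fin n) ℂ := Matrix.of fun q b => B (e q).1 (e q).2 b with hV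
  -- Naimark dilation: `V` stacks the factors B_j of T_j = B_j* B_j. Taking d = 1 gives V* V = 1;
  -- taking the i-th vertex coordinates gives X_i.
  have hVdV : ∀ d : Fin (g + 1) → ℝ, Vᴴ * Matrix.diagonal (fun q => ((d (e q).1 : ℝ) : ℂ)) * V =
      ∑ j, d j • bary a c X j := by
    intro d
    ext p r
    rw [Matrix.mul_apply, ← e.symm.sum_comp, Fintype.sum_prod_type, Matrix.sum_apply]
    refine Finset.sum_congr rfl fun j _ => ?_
    rw [Matrix.smul_apply, hB, Matrix.mul_apply, Finset.smul_sum]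
    refine Finset.sum_congr rfl fun q _ => ?_
    rw [Matrix.mul_diagonal]
    simp only [hV, Matrix.conjTranspose_apply, Matrix.of_apply, Equiv.apply_symm_apply,
      Complex.real_smul]
    ring
  refine ⟨fun i => Matrix.diagonal (fun q => ((x (e q).1 i : ℝ) : ℂ)), V, ?_, ?_, ?_, ?_⟩
  · rw [hK]
    refine ⟨fun i => ?_, fun j => ?_⟩
    · rw [Matrix.IsHermitian, Matrix.diagonal_conjTranspose]
      congr 1
      funext q
      simp
    · have h1 : bary a c (fun i => Matrix.diagonal (fun q => ((x (e q).1 i : ℝ) : ℂ))) j =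
          Matrix.diagonal (fun q => if j = (e q).1 then 1 else 0) := by
        ext p q
        by_cases hpq : p = q
        · subst hpq
          have := congrArg Complex.ofReal (hf.dual j (e p).1)
          push_cast at this
          simp [bary, slack, Matrix.sum_apply, this, apply_ite Complex.ofReal]
        · simp [bary, slack, Matrix.sum_apply, hpq]
      rw [h1]
      refine Matrix.PosSemidef.diagonal fun q => ?_
      dsimp only
      split_ifs <;> simp
  · have := hVdV (fun _ => 1)
    simp only [Complex.ofReal_one, Matrix.diagonal_one, Matrix.mul_one, one_smul, hf.sum_bary] at this
    exact this
  · intro i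
    rw [hVdV fun j => x j i]
    exact (congrFun (hf.ofBary_bary X) i).symm
  · intro i l
    rw [Matrix.diagonal_mul_diagonal, Matrix.diagonal_mul_diagonal]
    congr 1
    funext q
    ring

theorem IsFreeSimplex.not_isFreeExtreme_prod (hK : IsFreeSimplex a c K) (hf : IsSimplexFrame a c x)
    {X : Fin g → Matrix (Fin 2) (Fin 2) ℝ} (hX : IsEuclideanExtreme K (complexify X))
    (hXA : ¬ IsArvesonExtreme K (complexify X)) {Y : Matrix (Fin 2) (Fin 2) ℂ}
    (hY : IsArvesonExtreme (matrixInterval ℂ) (fun _ : Fin 1 => Y)) :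
    ¬ IsFreeExtreme (K.prod (matrixInterval ℂ))
      (Sum.elim (complexify X) (fun _ : Fin 1 => Y)) := by
  intro hfree
  obtain ⟨hYH, hYY⟩ := hY.mul_self_eq_one
  obtain ⟨Z, V, hZ, hV, hXZ, hZc⟩ := hK.exists_commuting_dilation hf hX.1
  have hYV : (fun _ : Fin 1 => V * Y * Vᴴ) ∈ matrixInterval ℂ ((g + 1) * 2) := by
    have h1 : V * Y * Vᴴ * (V * Y * Vᴴ) = V * Vᴴ := by
      calc V * Y * Vᴴ * (V * Y * Vᴴ) = V * Y * (Vᴴ * V) * Y * Vᴴ := by simp only [Matrix.mul_assoc]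
        _ = V * (Y * Y) * Vᴴ := by rw [hV, Matrix.mul_one, Matrix.mul_assoc V]
        _ = V * Vᴴ := by rw [hYY, Matrix.mul_one]
    refine mem_matrixInterval_of_mul_self (Matrix.isHermitian_mul_mul_conjTranspose V hYH) ?_
    rw [h1]
    have h2 : V * Vᴴ * (V * Vᴴ) = V * Vᴴ := by
      calc V * Vᴴ * (V * Vᴴ) = V * (Vᴴ * V) * Vᴴ := by simp only [Matrix.mul_assoc]
        _ = V * Vᴴ := by rw [hV, Matrix.mul_one]
    have h3 := Matrix.posSemidef_conjTranspose_mul_self (1 - V * Vᴴ)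
    rw [Matrix.conjTranspose_sub, Matrix.conjTranspose_one,
      (Matrix.isHermitian_mul_conjTranspose_self V), mul_sub, sub_mul, sub_mul, h2] at h3
    simpa using h3
  have h := hfree.2 1 (fun _ => (g + 1) * 2) (fun _ => Sum.elim Z (fun _ : Fin 1 => V * Y * Vᴴ))
    (fun _ => V) (fun _ => ⟨hZ, hYV⟩) ⟨fun _ => by positivity, by simpa using hV, ?_⟩ (fun _ h => by
      rw [h] at hV; simp at hV) 0
  · have hcomm : ∀ i l, complexify X i * complexify X l = complexify X l * complexify X i := by
      intro i l
      rcases h with ⟨-, h⟩ | ⟨-, m, W, -, h⟩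
      · exact commute_of_unitarilyEquivalent h (i := Sum.inl i) (l := Sum.inl l) (hZc i l)
      · have := commute_of_unitarilyEquivalent h (i := Sum.inl i) (l := Sum.inl l) (hZc i l)
        rw [blockMat_mul, blockMat_mul, blockMat_inj] at this
        simpa using this.1
    obtain ⟨j, k, hjk⟩ := hK.exists_bary_not_commute hf hX hXA
    refine hjk (commute_bary (fun i l => ?_) j k)
    have := hcomm i l
    simp only [complexify] at this
    refine Matrix.map_injective Complex.ofReal_injective ?_
    have h1 := fun i l => Matrix.map_mul (L := X i) (M := X l) (f := Complex.ofRealHom)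
    exact (h1 i l).trans (this.trans (h1 l i).symm)
  · rintro (i | i)
    · simpa using hXZ i
    · have : Vᴴ * (V * Y * Vᴴ) * V = Y := by
        calc Vᴴ * (V * Y * Vᴴ) * V = (Vᴴ * V) * Y * (Vᴴ * V) := by simp only [Matrix.mul_assoc]
          _ = Y := by rw [hV, Matrix.mul_one, Matrix.one_mul]
      simp [this]

end complex

/-! ### Tilting a resolution of the identity by an involution -/

section tilt

variable {n : ℕ} {F : Matrix (Fin n) (Fin n) ℝ} {p q : ℝ}

/-- The matrix `p + q F`. -/
def tilt (F : Matrix (Fin n) (Fin n) ℝ) (p q : ℝ) : Matrix (Fin n) (Fin n) ℝ := p • 1 + q • F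

/-- The inverse of `p + q F` if `F` is an involution and `p ^ 2 ≠ q ^ 2`. -/
def tiltInv (F : Matrix (Fin n) (Fin n) ℝ) (p q : ℝ) : Matrix (Fin n) (Fin n) ℝ :=
  (p ^ 2 - q ^ 2)⁻¹ • tilt F p (-q)

theorem tilt_mul_tilt (hF : F * F = 1) (p q r : ℝ) :
    tilt F p q * tilt F p r = (p ^ 2 + q * r) • 1 + (p * (q + r)) • F := by
  simp only [tilt, add_mul, mul_add, Matrix.smul_mul, Matrix.mul_smul, Matrix.one_mul,
    Matrix.mul_one, hF]
  module

theorem tilt_mul_self (hF : F * F = 1) (h : p ^ 2 + q ^ 2 = 1 / 2) :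
    tilt F p q * tilt F p q = (1 / 2 : ℝ) • (1 + (4 * p * q) • F) := by
  rw [tilt_mul_tilt hF, ← pow_two, h]
  module

theorem tilt_mul_tiltInv (hF : F * F = 1) (h : p ^ 2 - q ^ 2 ≠ 0) :
    tilt F p q * tiltInv F p q = 1 := by
  rw [tiltInv, Matrix.mul_smul, tilt_mul_tilt hF, add_neg_cancel, mul_zero, zero_smul, add_zero,
    smul_smul, mul_neg, ← pow_two, ← sub_eq_add_neg, inv_mul_cancel₀ h, one_smul]

theorem tiltInv_mul_tilt (hF : F * F = 1) (h : p ^ 2 - q ^ 2 ≠ 0) :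
    tiltInv F p q * tilt F p q = 1 := by
  rw [tiltInv, Matrix.smul_mul, tilt_mul_tilt hF, neg_add_cancel, mul_zero, zero_smul, add_zero,
    smul_smul, neg_mul, ← pow_two, ← sub_eq_add_neg, inv_mul_cancel₀ h, one_smul]

theorem tilt_isHermitian (hF : F.IsHermitian) (p q : ℝ) : (tilt F p q)ᴴ = tilt F p q := by
  rw [tilt, Matrix.conjTranspose_add, Matrix.conjTranspose_smul, Matrix.conjTranspose_smul, hF]
  simp

theorem tiltInv_isHermitian (hF : F.IsHermitian) (p q : ℝ) : (tiltInv F p q)ᴴ = tiltInv F p q := by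
  rw [tiltInv, Matrix.conjTranspose_smul, tilt_isHermitian hF]
  simp

/-- The resolution of the identity obtained from `T` by the weights `(1 + 4 p q f) / 2`. -/
def tiltedResolution {ι : Type} (F : Matrix (Fin n) (Fin n) ℝ) (f : ι → ℝ)
    (T : ι → Matrix (Fin n) (Fin n) ℝ) (p q : ℝ) (j : ι) : Matrix (Fin n) (Fin n) ℝ :=
  ((1 + 4 * p * q * f j) / 2) • (tiltInv F p q * T j * tiltInv F p q)

theorem tilt_mul_tiltedResolution_mul_tilt {ι : Type} (hF : F * F = 1) (h : p ^ 2 - q ^ 2 ≠ 0)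
    (f : ι → ℝ) (T : ι → Matrix (Fin n) (Fin n) ℝ) (j : ι) :
    tilt F p q * tiltedResolution F f T p q j * tilt F p q = ((1 + 4 * p * q * f j) / 2) • T j := by
  rw [tiltedResolution, Matrix.mul_smul, Matrix.smul_mul]
  congr 1
  calc _ = (tilt F p q * tiltInv F p q) * T j * (tiltInv F p q * tilt F p q) := by
        simp only [Matrix.mul_assoc]
    _ = T j := by
      rw [tilt_mul_tiltInv hF h, tiltInv_mul_tilt hF h, Matrix.one_mul, Matrix.mul_one]

theorem sum_tiltedResolution {ι : Type} [Fintype ι] (hF : F * F = 1) (h : p ^ 2 - q ^ 2 ≠ 0)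
    (h' : p ^ 2 + q ^ 2 = 1 / 2) {f : ι → ℝ} {T : ι → Matrix (Fin n) (Fin n) ℝ}
    (hT : ∑ j, T j = 1) (hfT : ∑ j, f j • T j = F) : ∑ j, tiltedResolution F f T p q j = 1 := by
  have h1 : ∑ j, ((1 + 4 * p * q * f j) / 2) • T j = tilt F p q * tilt F p q := by
    rw [tilt_mul_self hF h', ← hT, ← hfT, Finset.smul_sum, ← Finset.sum_add_distrib,
      Finset.smul_sum]
    refine Finset.sum_congr rfl fun j _ => ?_
    module
  calc ∑ j, tiltedResolution F f T p q j
      = tiltInv F p q * (∑ j, ((1 + 4 * p * q * f j) / 2) • T j) * tiltInv F p q := by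
        rw [Matrix.mul_sum, Matrix.sum_mul]
        refine Finset.sum_congr rfl fun j _ => ?_
        rw [tiltedResolution, Matrix.mul_smul, Matrix.smul_mul]
    _ = (tiltInv F p q * tilt F p q) * (tilt F p q * tiltInv F p q) := by
        rw [h1]; simp only [Matrix.mul_assoc]
    _ = 1 := by rw [tilt_mul_tiltInv hF h, tiltInv_mul_tilt hF h, Matrix.one_mul]

theorem tiltedResolution_posSemidef {ι : Type} (hF : F.IsHermitian) {f : ι → ℝ}
    {T : ι → Matrix (Fin n) (Fin n) ℝ} {j : ι} (hT : (T j).PosSemidef)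
    (hf : 0 ≤ 1 + 4 * p * q * f j) : (tiltedResolution F f T p q j).PosSemidef := by
  have h := hT.conjTranspose_mul_mul_same (tiltInv F p q)
  rw [tiltInv_isHermitian hF] at h
  exact h.smul (by positivity)

end tilt

/-! ### Real symmetric matrices of size two -/

section fin_two

theorem reflection_mul_self {α β : ℝ} (h : α ^ 2 + β ^ 2 = 1) :
    !![α, β; β, -α] * !![α, β; β, -α] = (1 : Matrix (Fin 2) (Fin 2) ℝ) := by
  ext i k
  fin_cases i <;> fin_cases k <;> simp [Matrix.mul_apply, Fin.sum_univ_two] <;> linarith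

theorem Matrix.trace_mul_self_of_det_eq_zero {T : Matrix (Fin 2) (Fin 2) ℝ} (h : T.det = 0) :
    (T * T).trace = T.trace ^ 2 := by
  rw [Matrix.det_fin_two] at h
  simp only [Matrix.trace_fin_two, Matrix.mul_apply, Fin.sum_univ_two]
  linear_combination (-2) * h

theorem det_tiltedResolution {ι : Type} {F : Matrix (Fin 2) (Fin 2) ℝ} {f : ι → ℝ}
    {T : ι → Matrix (Fin 2) (Fin 2) ℝ} {j : ι} (h : (T j).det = 0) (p q : ℝ) :
    (tiltedResolution F f T p q j).det = 0 := by
  rw [tiltedResolution, Matrix.det_smul, Matrix.det_mul, Matrix.det_mul, h]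
  simp

theorem trace_tiltedResolution {ι : Type} {α β : ℝ} (hF : α ^ 2 + β ^ 2 = 1) {f : ι → ℝ}
    {T : ι → Matrix (Fin 2) (Fin 2) ℝ} {j : ι} {p q : ℝ} (h : p ^ 2 - q ^ 2 ≠ 0)
    (h' : p ^ 2 + q ^ 2 = 1 / 2) :
    (tiltedResolution !![α, β; β, -α] f T p q j).trace * (1 - (4 * p * q) ^ 2) =
      (1 + 4 * p * q * f j) *
        ((T j).trace - 4 * p * q * (T j * !![α, β; β, -α]).trace) := by
  have h1 : 1 - (4 * p * q) ^ 2 = 4 * (p ^ 2 - q ^ 2) ^ 2 := by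
    linear_combination (-4) * (p ^ 2 + q ^ 2 + 1 / 2) * h'
  have h2 : (tilt !![α, β; β, -α] p (-q) * T j * tilt !![α, β; β, -α] p (-q)).trace =
      (1 / 2 : ℝ) * ((T j).trace - 4 * p * q * (T j * !![α, β; β, -α]).trace) := by
    rw [Matrix.trace_mul_comm, ← Matrix.mul_assoc, tilt_mul_self (reflection_mul_self hF) (by rw [neg_sq]; exact h'), Matrix.smul_mul, Matrix.trace_smul,
      Matrix.add_mul, Matrix.trace_add, Matrix.smul_mul, Matrix.trace_smul, Matrix.one_mul,
      Matrix.trace_mul_comm !![α, β; β, -α]]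
    simp only [smul_eq_mul]
    ring
  rw [h1, tiltedResolution, tiltInv, Matrix.trace_smul]
  simp only [Matrix.smul_mul, Matrix.mul_smul, Matrix.trace_smul, h2, smul_eq_mul]
  field_simp
  ring

/-- Two non-commuting symmetric 2 × 2 matrices and the identity span all symmetric ones, and here
the identity is itself the sum of the T_l. -/
theorem exists_sum_smul_eq_of_not_commute {ι : Type} [Fintype ι] {T : ι → Matrix (Fin 2) (Fin 2) ℝ}
    (hT : ∀ j, (T j).IsHermitian) (hsum : ∑ j, T j = 1) {j k : ι} (hjk : T j * T k ≠ T k * T j)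
    (α β : ℝ) : ∃ f : ι → ℝ, ∑ l, f l • T l = !![α, β; β, -α] := by
  classical
  have sym : ∀ l, T l 1 0 = T l 0 1 := fun l => by simpa using (hT l).apply 0 1
  -- Up to sign the off-diagonal entry of the commutator, and also the Cramer determinant for
  -- matching the off-diagonal entry and the difference of the diagonal entries; `w` then fixes the
  -- trace.
  set D := T j 0 1 * (T k 0 0 - T k 1 1) - T k 0 1 * (T j 0 0 - T j 1 1) with hD
  have hD0 : D ≠ 0 := by
    intro h
    rw [hD] at h
    apply hjk
    ext a b
    fin_cases a <;> fin_cases b <;> simp [Matrix.mul_apply, Fin.sum_univ_two, sym] <;>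
      linarith
  set u := (β * (T k 0 0 - T k 1 1) - T k 0 1 * (2 * α)) / D with hu
  set v := (T j 0 1 * (2 * α) - β * (T j 0 0 - T j 1 1)) / D with hv
  have e1 : u * T j 0 1 + v * T k 0 1 = β := by
    rw [hu, hv]; field_simp; rw [hD]; ring
  have e2 : u * (T j 0 0 - T j 1 1) + v * (T k 0 0 - T k 1 1) = 2 * α := by
    rw [hu, hv]; field_simp; rw [hD]; ring
  set w := α - u * T j 0 0 - v * T k 0 0 with hw
  refine ⟨fun l => w + (if l = j then u else 0) + (if l = k then v else 0), ?_⟩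
  simp only [add_smul, Finset.sum_add_distrib, ← Finset.smul_sum, hsum, ite_smul, zero_smul,
    Finset.sum_ite_eq', Finset.mem_univ, if_true]
  ext a b
  fin_cases a <;> fin_cases b <;> simp [sym, hw] <;> linarith

/-- For singular symmetric T, equality of |tr (TF)| and |tr T| means that T commutes with the
reflection F. Symmetric matrices commuting with F lie in the span of 1 and F, hence commute with
each other. -/
theorem mul_comm_of_trace_sq {α β : ℝ} (hαβ : α ^ 2 + β ^ 2 = 1) {T T' : Matrix (Fin 2) (Fin 2) ℝ}
    (hT : T.IsHermitian) (hT' : T'.IsHermitian) (h : T.det = 0) (h' : T'.det = 0)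
    (ht : (T * !![α, β; β, -α]).trace ^ 2 = T.trace ^ 2)
    (ht' : (T' * !![α, β; β, -α]).trace ^ 2 = T'.trace ^ 2) : T * T' = T' * T := by
  have key : ∀ M : Matrix (Fin 2) (Fin 2) ℝ, M.IsHermitian → M.det = 0 →
      (M * !![α, β; β, -α]).trace ^ 2 = M.trace ^ 2 →
      β * (M 0 0 - M 1 1) = 2 * α * M 0 1 ∧ M 1 0 = M 0 1 := by
    intro M hM hdet htr
    have sym : M 1 0 = M 0 1 := by simpa using hM.apply 0 1
    refine ⟨?_, sym⟩
    simp only [Matrix.det_fin_two, Matrix.trace_fin_two, Matrix.mul_apply, Fin.sum_univ_two,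
      sym] at hdet htr
    simp at htr
    have h0 : (β * (M 0 0 - M 1 1) - 2 * α * M 0 1) ^ 2 = 0 := by
      linear_combination ((M 0 0 - M 1 1) ^ 2 + 4 * (M 0 1) ^ 2) * hαβ - htr - 4 * hdet
    linarith [pow_eq_zero_iff (two_ne_zero) |>.mp h0]
  obtain ⟨e, s⟩ := key T hT h ht
  obtain ⟨e', s'⟩ := key T' hT' h' ht'
  have h0 : (T 0 0 - T 1 1) * T' 0 1 = (T' 0 0 - T' 1 1) * T 0 1 := by
    have h1 : α * ((T 0 0 - T 1 1) * T' 0 1 - (T' 0 0 - T' 1 1) * T 0 1) = 0 := by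
      linear_combination (-(T 0 0 - T 1 1) / 2) * e' + ((T' 0 0 - T' 1 1) / 2) * e
    have h2 : β * ((T 0 0 - T 1 1) * T' 0 1 - (T' 0 0 - T' 1 1) * T 0 1) = 0 := by
      linear_combination (T' 0 1) * e - (T 0 1) * e'
    linear_combination (α * h1 + β * h2) -
      ((T 0 0 - T 1 1) * T' 0 1 - (T' 0 0 - T' 1 1) * T 0 1) * hαβ
  ext a b
  fin_cases a <;> fin_cases b <;> simp [Matrix.mul_apply, Fin.sum_univ_two, s, s'] <;> linarith

/-- The entries of a hermitian unitary `2 × 2` matrix which is not real. -/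
theorem exists_entries_of_mul_self_eq_one {Y : Matrix (Fin 2) (Fin 2) ℂ} (hY : Y.IsHermitian)
    (hYY : Y * Y = 1) (hYim : Y.map Complex.im ≠ 0) :
    ∃ r s t : ℝ, t ≠ 0 ∧ t = (Y 0 1).im ∧ r ^ 2 + s ^ 2 + t ^ 2 = 1 ∧
      Y.map Complex.re = !![r, s; s, -r] ∧ Y.map Complex.im = !![0, t; -t, 0] := by
  have d0 := hY.apply 0 0
  have d1 := hY.apply 1 1
  have d2 := hY.apply 0 1
  have e00 := congrFun (congrFun hYY 0) 0
  have e01 := congrFun (congrFun hYY 0) 1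
  simp only [Matrix.mul_apply, Fin.sum_univ_two, Matrix.one_apply] at e00 e01
  simp [Complex.ext_iff] at d0 d1 d2 e00 e01
  have g0 : (Y 0 0).im = 0 := by linarith
  have g1 : (Y 1 1).im = 0 := by linarith
  have g2 : (Y 1 0).im = -(Y 0 1).im := by linarith [d2.2]
  have hM : Y.map Complex.im = !![0, (Y 0 1).im; -(Y 0 1).im, 0] := by
    ext i j; fin_cases i <;> fin_cases j <;> simp [g0, g1, g2]
  have ht : (Y 0 1).im ≠ 0 := by
    intro h
    apply hYim
    rw [hM, h]
    ext i j; fin_cases i <;> fin_cases j <;> simp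
  have hr : (Y 1 1).re = -(Y 0 0).re := by
    have h1 := e01.2
    rw [g0, g1] at h1
    have h2 : ((Y 0 0).re + (Y 1 1).re) * (Y 0 1).im = 0 := by linarith
    linarith [(mul_eq_zero.mp h2).resolve_right ht]
  refine ⟨(Y 0 0).re, (Y 0 1).re, (Y 0 1).im, ht, rfl, ?_, ?_, hM⟩
  · have h1 := e00.1
    rw [g0, g2, d2.1] at h1
    linarith
  · ext i j; fin_cases i <;> fin_cases j <;> simp [hr, d2.1]

end fin_two

/-! ### Direct sums, their traces, and the choice of parameters -/

section diagonal

variable {𝕜 : Type} [RCLike 𝕜] {g n m : ℕ} {a : Fin (g + 1) → Fin g → ℝ} {c : Fin (g + 1) → ℝ}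

theorem bary_blockMat (X : Fin g → Matrix (Fin n) (Fin n) 𝕜) (Z : Fin g → Matrix (Fin m) (Fin m) 𝕜)
    (j : Fin (g + 1)) :
    bary a c (fun i => blockMat (X i) 0 0 (Z i)) j =
      blockMat (bary a c X j) 0 0 (bary a c Z j) := by
  have := submatrix_bary_blockMat (a := a) (c := c) X 0 0 Z j
  simp only [Pi.zero_apply, smul_zero, Finset.sum_const_zero, neg_zero] at this
  rw [blockMat, ← this, Matrix.reindex_apply, Matrix.submatrix_submatrix]
  simp

theorem IsFreeSimplex.blockMat_mem {K : GradedSet 𝕜 (Fin g)} (hK : IsFreeSimplex a c K)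
    {X : Fin g → Matrix (Fin n) (Fin n) 𝕜} {Z : Fin g → Matrix (Fin m) (Fin m) 𝕜} (hX : X ∈ K n)
    (hZ : Z ∈ K m) : (fun i => blockMat (X i) 0 0 (Z i)) ∈ K (n + m) := by
  rw [hK] at *
  refine ⟨fun i => ?_, fun j => ?_⟩
  · rw [Matrix.IsHermitian, blockMat_conjTranspose, hX.1, hZ.1]
    simp
  · rw [bary_blockMat]
    exact (hX.2 j).blockMat (hZ.2 j)

theorem trace_blockMat (A : Matrix (Fin m) (Fin m) 𝕜) (B : Matrix (Fin m) (Fin n) 𝕜)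
    (C : Matrix (Fin n) (Fin m) 𝕜) (D : Matrix (Fin n) (Fin n) 𝕜) :
    (blockMat A B C D).trace = A.trace + D.trace := by
  simp [Matrix.trace, blockMat, Fin.sum_univ_add]

theorem blockMat_add (A A' : Matrix (Fin m) (Fin m) 𝕜) (B B' : Matrix (Fin m) (Fin n) 𝕜)
    (C C' : Matrix (Fin n) (Fin m) 𝕜) (D D' : Matrix (Fin n) (Fin n) 𝕜) :
    blockMat A B C D + blockMat A' B' C' D' = blockMat (A + A') (B + B') (C + C') (D + D') := by
  simp only [blockMat, Matrix.reindex_apply, ← Matrix.fromBlocks_add]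
  rfl

end diagonal

theorem trace_eq_of_blockMat_conj {T₁ T₂ T : Matrix (Fin 2) (Fin 2) ℝ} (h₁ : T₁.det = 0)
    (h₂ : T₂.det = 0) (h : T.det = 0) {U : Matrix (Fin (2 + 2)) (Fin (2 + 2)) ℝ} (hU : Uᴴ * U = 1)
    (hUT : U * blockMat T₁ 0 0 T₂ * Uᴴ = blockMat T 0 0 T) :
    T₁.trace = T.trace ∧ T₂.trace = T.trace := by
  have e1 := congrArg Matrix.trace hUT
  rw [Matrix.trace_mul_comm, ← Matrix.mul_assoc, hU, Matrix.one_mul, trace_blockMat,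
    trace_blockMat] at e1
  have e2 : (blockMat T₁ 0 0 T₂ * blockMat T₁ 0 0 T₂).trace =
      (blockMat T 0 0 T * blockMat T 0 0 T).trace := by
    rw [← hUT]
    have : U * blockMat T₁ 0 0 T₂ * Uᴴ * (U * blockMat T₁ 0 0 T₂ * Uᴴ) =
        U * (blockMat T₁ 0 0 T₂ * blockMat T₁ 0 0 T₂) * Uᴴ := by
      calc _ = U * blockMat T₁ 0 0 T₂ * (Uᴴ * U) * blockMat T₁ 0 0 T₂ * Uᴴ := by
            simp only [Matrix.mul_assoc]
        _ = _ := by rw [hU, Matrix.mul_one]; simp only [Matrix.mul_assoc]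
    rw [this, Matrix.trace_mul_comm (U * _), ← Matrix.mul_assoc, hU, Matrix.one_mul]
  simp only [blockMat_mul, trace_blockMat, Matrix.mul_zero, Matrix.zero_mul, add_zero, zero_add,
    Matrix.trace_mul_self_of_det_eq_zero h₁, Matrix.trace_mul_self_of_det_eq_zero h₂,
    Matrix.trace_mul_self_of_det_eq_zero h] at e2
  -- Singular blocks satisfy tr (T²) = (tr T)², so the two traces have the same sum and the same sum
  -- of squares as two copies of tr T.
  have e3 : (T₁.trace - T₂.trace) ^ 2 = 0 := by
    linear_combination 2 * e2 - (T₁.trace + T₂.trace + 2 * T.trace) * e1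
  have e4 := (pow_eq_zero_iff two_ne_zero).mp e3
  constructor <;> linarith

/-- A real symmetric reflection commuting with a given traceless symmetric matrix. -/
theorem exists_reflection_direction (r s : ℝ) :
    ∃ α β : ℝ, α ^ 2 + β ^ 2 = 1 ∧ α * s = β * r := by
  by_cases h : r ^ 2 + s ^ 2 = 0
  · have hr : r = 0 := by nlinarith [sq_nonneg r, sq_nonneg s]
    have hs : s = 0 := by nlinarith [sq_nonneg r, sq_nonneg s]
    exact ⟨1, 0, by norm_num, by rw [hr, hs]; norm_num⟩
  · have h0 : 0 ≤ r ^ 2 + s ^ 2 := by positivity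
    have h1 : Real.sqrt (r ^ 2 + s ^ 2) ≠ 0 := by
      rw [Ne, Real.sqrt_eq_zero h0]; exact h
    refine ⟨r / Real.sqrt (r ^ 2 + s ^ 2), s / Real.sqrt (r ^ 2 + s ^ 2), ?_, by ring⟩
    rw [div_pow, div_pow, Real.sq_sqrt h0, ← add_div, div_self h]

theorem exists_tilt_parameters {ι : Type} [Fintype ι] (f : ι → ℝ) :
    ∃ p q : ℝ, p ^ 2 + q ^ 2 = 1 / 2 ∧ p ^ 2 - q ^ 2 ≠ 0 ∧ p * q ≠ 0 ∧
      ∀ j, |4 * p * q * f j| ≤ 1 := by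
  set B := 1 + ∑ j, |f j| with hB
  have hB1 : 1 ≤ B := by
    have : 0 ≤ ∑ j, |f j| := Finset.sum_nonneg fun _ _ => abs_nonneg _
    linarith
  have hfB : ∀ j, |f j| ≤ B := by
    intro j
    have : |f j| ≤ ∑ j, |f j| :=
      Finset.single_le_sum (f := fun j => |f j|) (fun _ _ => abs_nonneg _) (Finset.mem_univ j)
    linarith
  -- `B` bounds every |f_j| and p ≤ 1, so 4pq|f_j| ≤ 4qB = 1, which keeps all tilted weights
  -- nonnegative; q ≤ 1/4 also ensures p² > q².
  set q := 1 / (4 * B) with hq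
  have hq0 : 0 < q := by positivity
  have hq1 : q ≤ 1 / 4 := by
    rw [hq]; exact one_div_le_one_div_of_le (by norm_num) (by linarith)
  have hqB : 4 * q * B = 1 := by rw [hq]; field_simp
  have hqsq : q ^ 2 ≤ 1 / 16 := by nlinarith
  have hp2 : Real.sqrt (1 / 2 - q ^ 2) ^ 2 = 1 / 2 - q ^ 2 := Real.sq_sqrt (by linarith)
  set p := Real.sqrt (1 / 2 - q ^ 2) with hp
  have hp0 : 0 < p := Real.sqrt_pos.mpr (by linarith)
  have hp1 : p ≤ 1 := by nlinarith [sq_nonneg q]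
  refine ⟨p, q, by linarith, by rw [hp2]; linarith, by positivity, fun j => ?_⟩
  rw [abs_mul, abs_of_pos (by positivity : 0 < 4 * p * q)]
  calc 4 * p * q * |f j| ≤ 4 * 1 * q * B := by
        have := hfB j
        gcongr
    _ = 1 := by linarith

/-! ### The realification is not matrix extreme -/

section real

variable {g : ℕ} {a : Fin (g + 1) → Fin g → ℝ} {c : Fin (g + 1) → ℝ}
  {x : Fin (g + 1) → Fin g → ℝ} {K : GradedSet ℂ (Fin g)}

theorem realification_mem_matrixInterval {Y : Matrix (Fin 2) (Fin 2) ℂ} {r s t : ℝ}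
    (hrst : r ^ 2 + s ^ 2 + t ^ 2 = 1) (hre : Y.map Complex.re = !![r, s; s, -r])
    (him : Y.map Complex.im = !![0, t; -t, 0]) :
    (fun _ : Fin 1 => blockMat (Y.map Complex.re) (Y.map Complex.im)
      (Y.map Complex.im)ᵀ (Y.map Complex.re)) ∈ matrixInterval ℝ (2 + 2) := by
  have htr : !![0, t; -t, 0]ᵀ = !![0, -t; t, 0] := by
    ext i j; fin_cases i <;> fin_cases j <;> rfl
  refine mem_matrixInterval_of_mul_self ?_ ?_
  · rw [Matrix.IsHermitian, blockMat_conjTranspose, hre, him, blockMat_inj]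
    refine ⟨?_, ?_, ?_, ?_⟩ <;> ext i j <;> fin_cases i <;> fin_cases j <;> simp
  · have : blockMat (Y.map Complex.re) (Y.map Complex.im) (Y.map Complex.im)ᵀ (Y.map Complex.re) *
        blockMat (Y.map Complex.re) (Y.map Complex.im) (Y.map Complex.im)ᵀ (Y.map Complex.re) =
        1 := by
      rw [blockMat_mul, ← blockMat_one, blockMat_inj, hre, him, htr]
      refine ⟨?_, ?_, ?_, ?_⟩ <;> ext i j <;> fin_cases i <;> fin_cases j <;>
        simp <;> linarith
    rw [this, sub_self]
    exact Matrix.PosSemidef.zero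

theorem IsFreeSimplex.not_isMatrixExtreme_realification (hK : IsFreeSimplex a c K)
    (hf : IsSimplexFrame a c x) {X : Fin g → Matrix (Fin 2) (Fin 2) ℝ}
    (hX : IsEuclideanExtreme K (complexify X)) (hXA : ¬ IsArvesonExtreme K (complexify X))
    {Y : Matrix (Fin 2) (Fin 2) ℂ} {r s t : ℝ}
    (hrst : r ^ 2 + s ^ 2 + t ^ 2 = 1) (hre : Y.map Complex.re = !![r, s; s, -r])
    (him : Y.map Complex.im = !![0, t; -t, 0]) :
    ¬ IsMatrixExtreme (K.realPart.prod (matrixInterval ℝ))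
      (Sum.elim (fun j => blockMat (X j) 0 0 (X j))
        (fun _ : Fin 1 => blockMat (Y.map Complex.re) (Y.map Complex.im)
          (Y.map Complex.im)ᵀ (Y.map Complex.re))) := by
  intro hext
  have hKr := hK.realPart
  have hXr : X ∈ K.realPart 2 := hX.1
  have hYr := realification_mem_matrixInterval hrst hre him
  have hT := ((hKr _ _).mp hXr).2
  have hdet := hK.det_bary_eq_zero hf hX hXA
  obtain ⟨j₁, j₂, hj⟩ := hK.exists_bary_not_commute hf hX hXA
  obtain ⟨α, β, hαβ, hdir⟩ := exists_reflection_direction r s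
  set T := bary a c X with hTdef
  obtain ⟨f, hfF⟩ := exists_sum_smul_eq_of_not_commute (fun j => (hT j).1) (hf.sum_bary X) hj α β
  obtain ⟨p, q, hpq, hpq', hpq0, hpf⟩ := exists_tilt_parameters f
  set F : Matrix (Fin 2) (Fin 2) ℝ := !![α, β; β, -α] with hF
  have hFF : F * F = 1 := reflection_mul_self hαβ
  have hFH : F.IsHermitian := by
    ext i j; fin_cases i <;> fin_cases j <;> simp [hF]
  have hneg1 : p ^ 2 + (-q) ^ 2 = 1 / 2 := by rw [neg_sq]; exact hpq
  have hneg2 : p ^ 2 - (-q) ^ 2 ≠ 0 := by rw [neg_sq]; exact hpq'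
  set R := tiltedResolution F f T p with hR
  have hR1 : ∀ q', q' = q ∨ q' = -q → ∑ j, R q' j = 1 := by
    rintro q' (rfl | rfl)
    · exact sum_tiltedResolution hFF hpq' hpq (hf.sum_bary X) hfF
    · exact sum_tiltedResolution hFF hneg2 hneg1 (hf.sum_bary X) hfF
  have hRpos : ∀ q', q' = q ∨ q' = -q → ∀ j, (R q' j).PosSemidef := by
    rintro q' (rfl | rfl) j <;> refine tiltedResolution_posSemidef hFH (hT j) ?_ <;>
      have := abs_le.mp (hpf j) <;> linarith
  have hmem : ∀ q', q' = q ∨ q' = -q → ofBary x (R q') ∈ K.realPart 2 := fun q' h =>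
    hKr.ofBary_mem hf (hR1 q' h) (hRpos q' h)
  have htilt : ∀ q', q' = q ∨ q' = -q → ∀ i, tilt F p q' * ofBary x (R q') i * tilt F p q' =
      ∑ j, x j i • (((1 + 4 * p * q' * f j) / 2) • T j) := by
    intro q' h i
    rw [ofBary, Matrix.mul_sum, Matrix.sum_mul]
    refine Finset.sum_congr rfl fun j _ => ?_
    rw [Matrix.mul_smul, Matrix.smul_mul]
    congr 1
    rcases h with rfl | rfl
    · exact tilt_mul_tiltedResolution_mul_tilt hFF hpq' f T j
    · exact tilt_mul_tiltedResolution_mul_tilt hFF hneg2 f T j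
  have hsumX : ∀ i, ∑ j, x j i • (((1 + 4 * p * q * f j) / 2) • T j) +
      ∑ j, x j i • (((1 + 4 * p * (-q) * f j) / 2) • T j) = X i := by
    intro i
    rw [← Finset.sum_add_distrib]
    conv_rhs => rw [← hf.ofBary_bary X]
    refine Finset.sum_congr rfl fun j _ => ?_
    rw [← hTdef]
    module
  -- The second block carries the opposite sign because F anticommutes with Im Y: moving Im Y past p
  -- + qF turns q into -q.
  set W : ℝ → Matrix (Fin (2 + 2)) (Fin (2 + 2)) ℝ := fun q' =>
    blockMat (tilt F p q') 0 0 (tilt F p (-q')) with hW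
  have hWH : ∀ q', (W q')ᴴ = W q' := by
    intro q'
    rw [hW]
    dsimp only
    rw [blockMat_conjTranspose, tilt_isHermitian hFH, tilt_isHermitian hFH]
    simp
  have hWsum : W q * W q + W (-q) * W (-q) = 1 := by
    simp only [hW, neg_neg, blockMat_mul, Matrix.mul_zero, Matrix.zero_mul, add_zero, zero_add,
      tilt_mul_self hFF hpq, tilt_mul_self hFF hneg1, blockMat_add]
    rw [← blockMat_one, blockMat_inj]
    refine ⟨by module, rfl, rfl, by module⟩
  set Y' := blockMat (Y.map Complex.re) (Y.map Complex.im) (Y.map Complex.im)ᵀ (Y.map Complex.re)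
    with hY'
  have hWY : ∀ q', W q' * Y' = Y' * W q' := by
    intro q'
    have htE : ∀ q', tilt F p q' = !![p + q' * α, q' * β; q' * β, p - q' * α] := by
      intro q'
      ext i j
      fin_cases i <;> fin_cases j <;> simp [tilt, hF, sub_eq_add_neg]
    have htr : !![0, t; -t, 0]ᵀ = !![0, -t; t, 0] := by
      ext i j; fin_cases i <;> fin_cases j <;> rfl
    simp only [hW, hY', blockMat_mul, blockMat_inj, hre, him, htE, htr]
    refine ⟨?_, ?_, ?_, ?_⟩ <;> ext i j <;> fin_cases i <;> fin_cases j <;>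
      simp <;>
      first
        | ring1
        | linear_combination (2 * q') * hdir
        | linear_combination (-2 * q') * hdir
  have hWsurj : ∀ q', q' = q ∨ q' = -q → Function.Surjective (W q').mulVec := by
    intro q' h
    have h1 : W q' * blockMat (tiltInv F p q') 0 0 (tiltInv F p (-q')) = 1 := by
      rw [hW]
      dsimp only
      rw [blockMat_mul, ← blockMat_one, blockMat_inj]
      rcases h with rfl | rfl
      · simp [tilt_mul_tiltInv hFF hpq', tilt_mul_tiltInv hFF hneg2]
      · simp [tilt_mul_tiltInv hFF hpq', tilt_mul_tiltInv hFF hneg2]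
    intro v
    exact ⟨blockMat (tiltInv F p q') 0 0 (tiltInv F p (-q')) *ᵥ v, by
      rw [Matrix.mulVec_mulVec, h1, Matrix.one_mulVec]⟩
  set P : ℝ → Fin g ⊕ Fin 1 → Matrix (Fin (2 + 2)) (Fin (2 + 2)) ℝ := fun q' =>
    Sum.elim (fun l => blockMat (ofBary x (R q') l) 0 0 (ofBary x (R (-q')) l)) (fun _ => Y') with hP
  have hσ : ∀ i : Fin 2, ![q, -q] i = q ∨ ![q, -q] i = -q := by
    intro i; fin_cases i <;> simp
  have hσ' : ∀ q', q' = q ∨ q' = -q → -q' = q ∨ -q' = -q := by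
    rintro q' (rfl | rfl) <;> simp
  have hcomb := hext.2 2 (fun _ => 2 + 2) (fun i => P (![q, -q] i)) (fun i => W (![q, -q] i))
    (fun i => ⟨hKr.blockMat_mem (hmem _ (hσ i)) (hmem _ (hσ' _ (hσ i))), hYr⟩)
    ⟨fun _ => by norm_num, ?_, ?_⟩ (fun i => hWsurj _ (hσ i)) 0
  · obtain ⟨-, U, -, hU, hUP⟩ := hcomb
    have hUP' : ∀ l, U * blockMat (ofBary x (R q) l) 0 0 (ofBary x (R (-q)) l) * Uᴴ =
        blockMat (X l) 0 0 (X l) := fun l => hUP (Sum.inl l)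
    have hU' : U * Uᴴ = 1 := mul_eq_one_comm.mp hU
    have hbary : ∀ j, U * blockMat (R q j) 0 0 (R (-q) j) * Uᴴ = blockMat (T j) 0 0 (T j) := by
      intro j
      have h1 := bary_blockMat (a := a) (c := c) X X j
      rw [← funext hUP', bary_conj _ hU', bary_blockMat,
        hf.bary_ofBary (hR1 q (Or.inl rfl)), hf.bary_ofBary (hR1 (-q) (Or.inr rfl))] at h1
      exact h1
    have htr : ∀ j, (T j * F).trace ^ 2 = (T j).trace ^ 2 := by
      intro j
      obtain ⟨h1, h2⟩ := trace_eq_of_blockMat_conj (det_tiltedResolution (hdet j) p q)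
        (det_tiltedResolution (hdet j) p (-q)) (hdet j) hU (hbary j)
      have e1 := trace_tiltedResolution hαβ (f := f) (T := T) (j := j) hpq' hpq
      have e2 := trace_tiltedResolution hαβ (f := f) (T := T) (j := j) hneg2 hneg1
      rw [← hF] at e1 e2
      rw [h1] at e1
      rw [h2] at e2
      -- The trace formulas for q and -q have the same left side. Their odd part gives f_j tr T_j =
      -- tr (T_j F), their even part f_j tr (T_j F) = tr T_j; eliminating f_j yields the claim.
      have e3 : (p * q) * (f j * (T j).trace - (T j * F).trace) = 0 := by
        linear_combination (-1 / 8) * (e1 - e2)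
      have e4 : (p * q) * ((p * q) * (f j * (T j * F).trace - (T j).trace)) = 0 := by
        linear_combination (1 / 32) * (e1 + e2)
      have e5 := (mul_eq_zero.mp e3).resolve_left hpq0
      have e6 := (mul_eq_zero.mp ((mul_eq_zero.mp e4).resolve_left hpq0)).resolve_left hpq0
      linear_combination (T j).trace * e6 - (T j * F).trace * e5
    exact hj (mul_comm_of_trace_sq hαβ (hT j₁).1 (hT j₂).1 (hdet j₁) (hdet j₂) (htr j₁) (htr j₂))
  · rw [Fin.sum_univ_two]
    simp only [Matrix.cons_val_zero, Matrix.cons_val_one, hWH]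
    exact hWsum
  · rintro (l | l)
    · rw [Fin.sum_univ_two]
      simp only [Matrix.cons_val_zero, Matrix.cons_val_one, hWH, hP, Sum.elim_inl]
      simp only [hW, neg_neg, blockMat_mul, Matrix.mul_zero, Matrix.zero_mul, add_zero, zero_add,
        blockMat_add, htilt q (Or.inl rfl), htilt (-q) (Or.inr rfl)]
      rw [hsumX, add_comm (∑ j, x j l • (((1 + 4 * p * -q * f j) / 2) • T j)), hsumX]
    · rw [Fin.sum_univ_two]
      simp only [Matrix.cons_val_zero, Matrix.cons_val_one, hWH, hP, Sum.elim_inr]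
      rw [hWY, hWY, Matrix.mul_assoc, Matrix.mul_assoc, ← Matrix.mul_add, hWsum, Matrix.mul_one]

end real

/-! ### Assembly -/

theorem mainTheorem4 (g : ℕ) (S : Fin g → Matrix (Fin (g + 1)) (Fin (g + 1)) ℂ)
    (hS : DefinesFreeSimplex S)
    (X : Fin g → Matrix (Fin 2) (Fin 2) ℝ)
    (hX : IsEuclideanExtreme (freeSpectrahedron S) (complexify X))
    (hXA : ¬ IsArvesonExtreme (freeSpectrahedron S) (complexify X))
    (Y : Matrix (Fin 2) (Fin 2) ℂ)
    (hY : IsArvesonExtreme (matrixInterval ℂ) (fun _ : Fin 1 => Y))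
    (hYim : Y.map Complex.im ≠ 0) :
    IsMatrixExtreme ((freeSpectrahedron S).prod (matrixInterval ℂ))
        (Sum.elim (complexify X) (fun _ : Fin 1 => Y)) ∧
      ¬ IsFreeExtreme ((freeSpectrahedron S).prod (matrixInterval ℂ))
        (Sum.elim (complexify X) (fun _ : Fin 1 => Y)) ∧
      Sum.elim (fun j => blockMat (X j) 0 0 (X j))
          (fun _ : Fin 1 => blockMat (Y.map Complex.re) (Y.map Complex.im)
            (Y.map Complex.im)ᵀ (Y.map Complex.re)) ∈
        ((freeSpectrahedron S).realPart.prod (matrixInterval ℝ)) 4 ∧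
      ¬ IsMatrixExtreme ((freeSpectrahedron S).realPart.prod (matrixInterval ℝ))
        (Sum.elim (fun j => blockMat (X j) 0 0 (X j))
          (fun _ : Fin 1 => blockMat (Y.map Complex.re) (Y.map Complex.im)
            (Y.map Complex.im)ᵀ (Y.map Complex.re))) := by
  obtain ⟨a, ha⟩ := hS.exists_slack
  obtain ⟨c, x, hf⟩ := exists_simplexFrame a (eq_zero_of_forall_slack_nonpos hS ha)
  have hK : IsFreeSimplex a c (freeSpectrahedron S) := by
    intro n Z
    rw [ha]
    refine and_congr_right fun _ => forall_congr' fun j => ⟨fun h => h.smul (hf.pos j).le, fun h => ?_⟩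
    have := h.smul (inv_nonneg.mpr (hf.pos j).le)
    rwa [bary, smul_smul, inv_mul_cancel₀ (hf.pos j).ne', one_smul] at this
  obtain ⟨hYH, hYY⟩ := hY.mul_self_eq_one
  obtain ⟨r, s, t, ht, htY, hrst, hre, him⟩ := exists_entries_of_mul_self_eq_one hYH hYY hYim
  exact ⟨hK.isMatrixExtreme_prod hf hX hXA hY (htY ▸ ht), hK.not_isFreeExtreme_prod hf hX hXA hY,
    ⟨hK.realPart.blockMat_mem hX.1 hX.1, realification_mem_matrixInterval hrst hre him⟩,
    hK.not_isMatrixExtreme_realification hf hX hXA hrst hre him⟩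

end
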